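/- Let $k$ be a field and $n\ge 2$. Let $G=A_{n+3}$ be the anticycle on $n+3$ vertices, i.e. the complement of the cycle whose vertices are, in cyclic order, $x,z_1,y_1,\dots,y_n,z_2$. Let $R$ be the polynomial ring over $k$ whose variables are these vertices; the edge ideal of a graph on some of these vertices is the ideal of $R$ generated by the products $uv$ over its edges $\{u,v\}$. Let $H=G\setminus\{x\}$ (an antipath), $J=I(H)$, and let $K$ be the edge ideal on the edges of $G$ not in $H$. Then $K=(xy_1,\dots,xy_n)$, and $I(G)^2$ has linear quotients: its minimal monomial generators can be listed as $m_1,\dots,m_r$ so that for every $i>1$ the colon ideal $(m_1,\dots,m_{i-1}):(m_i)$ is generated by a set of variables. Such a list is obtained by writing the following blocks one after the other; in a block ordered by lex, lex-larger monomials come earlier. 1. The minimal monomial generators of $J^2$, in lex order with $z_1>y_1>\cdots>y_n>z_2$. (The result also holds if the lex order with $z_1<y_1<\cdots<y_n<z_2$ is used in this block.) 2. The generators in $JK$: (a) $xy_iz_1z_2$ for $i=1,\dots,n$; (b) $xy_iy_jz_2$ with $i\le j$, in lex order with $y_1>\cdots>y_n$, omitting the non-generator $xy_n^2z_2$; (c)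 $xy_iy_jz_1$ with $i\le j$, in lex order with $y_1<\cdots<y_n$, omitting the non-generator $xy_1^2z_1$; (d) the monomials $xy_iy_jy_l$ with $i\le j\le l$ that lie in $JK$, in lex order with $y_1>\cdots>y_n$. 3. The generators in $K^2$: (a) $x^2y_iy_j$ with $i\le j$, omitting $x^2y_1^2$, in lex order with $y_1>\cdots>y_n$; (b) $x^2y_1^2$. Consequently $I(G)^2$, which is generated in degree $4$, has a linear resolution: its graded Betti numbers satisfy $\beta_{i,j}(I(G)^2)=0$ for $j\ne i+4$. -/

import Mathlib

open MvPolynomial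

noncomputable section

/-! ## Edge ideals and monomial ideals -/

/-- The edge ideal of a simple graph `G` on the vertex set `V`, in the polynomial ring `k[V]`. -/
def edgeIdeal (k : Type*) [Field k] {V : Type*} (G : SimpleGraph V) : Ideal (MvPolynomial V k) :=
  Ideal.span {p | ∃ a b, G.Adj a b ∧ p = X a * X b}

/-- The ideal generated by the monomials whose exponent vectors lie in `S`. -/
def monomialIdeal (k : Type*) [Field k] {V : Type*} (S : Set (V →₀ ℕ)) :
    Ideal (MvPolynomial V k) :=
  Ideal.span ((fun m => monomial m (1 : k)) '' S)

/-- The monomial with exponent vector `m` is a minimal monomial generator of the (monomial)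
ideal `I`: it lies in `I`, and no proper divisor of it does. -/
def IsMinimalMonomial {k : Type*} [Field k] {V : Type*} (I : Ideal (MvPolynomial V k))
    (m : V →₀ ℕ) : Prop :=
  monomial m (1 : k) ∈ I ∧ ∀ m' ≤ m, monomial m' (1 : k) ∈ I → m' = m

/-- The list `L = (m₁, …, m_r)` of monomials (given by exponent vectors) is a linear quotients
ordering of `I`: the `mᵢ` are distinct and form a minimal generating set of `I`, and each colon
ideal `(m₁, …, mᵢ₋₁) : (mᵢ)`, `i > 1`, is generated by a set of variables. -/
structure IsLinearQuotientsOrdering {k : Type*} [Field k] {V : Type*}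
    (I : Ideal (MvPolynomial V k)) (L : List (V →₀ ℕ)) : Prop where
  nodup : L.Nodup
  span_eq : monomialIdeal k {m | m ∈ L} = I
  minimal : ∀ m ∈ L, monomial m (1 : k) ∉ monomialIdeal k {m' | m' ∈ L ∧ m' ≠ m}
  colon_eq : ∀ (i : ℕ) (hi : i < L.length), 0 < i →
    ∃ S : Set V, (monomialIdeal k {m | m ∈ L.take i}).colon {monomial L[i] (1 : k)} =
      Ideal.span ((fun v => (X v : MvPolynomial V k)) '' S)

/-! ## Graded Betti numbers and linear resolutions -/

/-- A minimal graded free resolution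
`⋯ → ⨁_q R(-deg 1 q) → ⨁_p R(-deg 0 p) → I → 0`
of an ideal `I` of `R = k[V]` (with the standard grading), written in homogeneous bases:
`gen p` is the image in `I` of the `p`-th basis element of the `0`-th free module, and
`d i` is the matrix of the differential from the `(i+1)`-st to the `i`-th free module. -/
structure MinimalGradedFreeResolution {k : Type*} [Field k] {V : Type*}
    (I : Ideal (MvPolynomial V k)) where
  /-- rank of the `i`-th free module -/
  rank : ℕ → ℕ
  /-- degrees of its basis elements -/
  deg : (i : ℕ) → Fin (rank i) → ℕ
  /-- the augmentation -/
  gen : Fin (rank 0) → MvPolynomial V k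
  /-- the differentials -/
  d : (i : ℕ) → Matrix (Fin (rank i)) (Fin (rank (i + 1))) (MvPolynomial V k)
  gen_homogeneous : ∀ p, (gen p).IsHomogeneous (deg 0 p)
  d_homogeneous : ∀ i p q, d i p q = 0 ∨
    ∃ e, deg (i + 1) q = deg i p + e ∧ (d i p q).IsHomogeneous e
  /-- all entries of the differentials lie in the ideal generated by the variables -/
  minimal : ∀ i p q, constantCoeff (d i p q) = 0
  gen_span : Ideal.span (Set.range gen) = I
  exact_zero : ∀ v : Fin (rank 0) → MvPolynomial V k,
    ∑ p, v p * gen p = 0 ↔ ∃ w, (d 0).mulVec w = v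
  exact_succ : ∀ (i : ℕ) (v : Fin (rank (i + 1)) → MvPolynomial V k),
    (d i).mulVec v = 0 ↔ ∃ w, (d (i + 1)).mulVec w = v

/-- The graded Betti number `β_{i,j}` read off a minimal graded free resolution: the number of
basis elements of degree `j` of the `i`-th free module. -/
def MinimalGradedFreeResolution.betti {k : Type*} [Field k] {V : Type*}
    {I : Ideal (MvPolynomial V k)} (F : MinimalGradedFreeResolution I) (i j : ℕ) : ℕ :=
  Nat.card {p : Fin (F.rank i) // F.deg i p = j}

/-- `I` (generated in degree `e`) has a linear resolution: `β_{i,j}(I) = 0` for `j ≠ i + e`. -/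
def HasLinearResolution {k : Type*} [Field k] {V : Type*}
    (I : Ideal (MvPolynomial V k)) (e : ℕ) : Prop :=
  ∃ F : MinimalGradedFreeResolution I, ∀ i j, j ≠ i + e → F.betti i j = 0

/-! ## The anticycle and its vertices

The anticycle on `n + 3` vertices is the complement of the cycle `0, 1, …, n + 2`.  Going around
the cycle, the vertices are called `x, z₁, y₁, …, yₙ, z₂`. -/

/-- The anticycle graph on `N` vertices. -/
def anticycle (N : ℕ) : SimpleGraph (Fin N) := (SimpleGraph.cycleGraph N)ᶜ

namespace Anticycle

/-- The vertex `x`. -/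
def x (n : ℕ) : Fin (n + 3) := ⟨0, by omega⟩

/-- The vertex `z₁`, following `x` on the cycle. -/
def z₁ (n : ℕ) : Fin (n + 3) := ⟨1, by omega⟩

/-- The vertex `z₂`, preceding `x` on the cycle. -/
def z₂ (n : ℕ) : Fin (n + 3) := ⟨n + 2, by omega⟩

/-- The vertices `y₁, …, yₙ`; the index is shifted, so that `y i` stands for `y_{i+1}`. -/
def y {n : ℕ} (i : Fin n) : Fin (n + 3) := ⟨i + 2, by omega⟩

/-- The antipath `H = G \ {x}`, kept as a graph on all vertices in which `x` is isolated, so that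
its edge ideal lives in the polynomial ring of `G`. -/
def H (n : ℕ) : SimpleGraph (Fin (n + 3)) := (anticycle (n + 3)).deleteIncidenceSet (x n)

/-- `J = I(H)`. -/
def J (k : Type*) [Field k] (n : ℕ) : Ideal (MvPolynomial (Fin (n + 3)) k) := edgeIdeal k (H n)

/-- `K = I(G \ H)`, the edge ideal on the edges of `G` that are not in `H`. -/
def K (k : Type*) [Field k] (n : ℕ) : Ideal (MvPolynomial (Fin (n + 3)) k) :=
  edgeIdeal k (anticycle (n + 3) \ H n)

/-- The exponent vector of the monomial `abcd`. -/
def exps {n : ℕ} (a b c d : Fin (n + 3)) : Fin (n + 3) →₀ ℕ :=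
  Finsupp.single a 1 + Finsupp.single b 1 + Finsupp.single c 1 + Finsupp.single d 1

/-- `L` lists the elements of `S` from the lex-largest to the lex-smallest monomial, where
`above v w` says that the variable `v` is larger than the variable `w`: a monomial `m` comes
before `m'` if, at the largest variable where they differ, `m` has the larger exponent. -/
structure IsLexListing {n : ℕ} (above : Fin (n + 3) → Fin (n + 3) → Prop)
    (S : Set (Fin (n + 3) →₀ ℕ)) (L : List (Fin (n + 3) →₀ ℕ)) : Prop where
  mem_iff : ∀ m, m ∈ L ↔ m ∈ S
  sorted : L.Pairwise (Finsupp.Lex above (· > ·))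

/-- Block (1): the minimal monomial generators of `J²`. -/
def block1 (k : Type*) [Field k] (n : ℕ) : Set (Fin (n + 3) →₀ ℕ) :=
  {m | IsMinimalMonomial (J k n ^ 2) m}

/-- Block (2a): the monomials `x yᵢ z₁ z₂`. -/
def block2a (n : ℕ) : Set (Fin (n + 3) →₀ ℕ) :=
  {m | ∃ i : Fin n, m = exps (x n) (y i) (z₁ n) (z₂ n)}

/-- Block (2b): the monomials `x yᵢ yⱼ z₂`, `i ≤ j`, except `x yₙ² z₂`. -/
def block2b (n : ℕ) : Set (Fin (n + 3) →₀ ℕ) :=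
  {m | ∃ i j : Fin n, i ≤ j ∧ ¬ ((i : ℕ) + 1 = n ∧ (j : ℕ) + 1 = n) ∧
    m = exps (x n) (y i) (y j) (z₂ n)}

/-- Block (2c): the monomials `x yᵢ yⱼ z₁`, `i ≤ j`, except `x y₁² z₁`. -/
def block2c (n : ℕ) : Set (Fin (n + 3) →₀ ℕ) :=
  {m | ∃ i j : Fin n, i ≤ j ∧ ¬ ((i : ℕ) = 0 ∧ (j : ℕ) = 0) ∧
    m = exps (x n) (y i) (y j) (z₁ n)}

/-- Block (2d): the monomials `x yᵢ yⱼ yₗ`, `i ≤ j ≤ l`, that lie in `J K`. -/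
def block2d (k : Type*) [Field k] (n : ℕ) : Set (Fin (n + 3) →₀ ℕ) :=
  {m | monomial m (1 : k) ∈ J k n * K k n ∧
    ∃ i j l : Fin n, i ≤ j ∧ j ≤ l ∧ m = exps (x n) (y i) (y j) (y l)}

/-- Block (3a): the monomials `x² yᵢ yⱼ`, `i ≤ j`, except `x² y₁²`. -/
def block3a (n : ℕ) : Set (Fin (n + 3) →₀ ℕ) :=
  {m | ∃ i j : Fin n, i ≤ j ∧ ¬ ((i : ℕ) = 0 ∧ (j : ℕ) = 0) ∧
    m = exps (x n) (x n) (y i) (y j)}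

/-- Block (3b): the monomial `x² y₁²`. -/
def block3b (n : ℕ) : Set (Fin (n + 3) →₀ ℕ) :=
  {m | ∃ i : Fin n, (i : ℕ) = 0 ∧ m = exps (x n) (x n) (y i) (y i)}

/-- `L` is the concatenation of the blocks (1), (2a), (2b), (2c), (2d), (3a), (3b).
With `· < ·` the larger variables are those of smaller index
(`x > z₁ > y₁ > ⋯ > yₙ > z₂`), with `· > ·` those of larger index.
Block (2c) is in lex order with `y₁ < ⋯ < yₙ`, the blocks (2b), (2d), (3a) are in lex order with
`y₁ > ⋯ > yₙ`, block (2a) is listed by increasing `i`, and block (1) is in lex order with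
respect to the order `above` of the variables. -/
def IsAnticycleOrdering (k : Type*) [Field k] (n : ℕ)
    (above : Fin (n + 3) → Fin (n + 3) → Prop) (L : List (Fin (n + 3) →₀ ℕ)) : Prop :=
  ∃ L1 L2a L2b L2c L2d L3a L3b : List (Fin (n + 3) →₀ ℕ),
    IsLexListing above (block1 k n) L1 ∧
    IsLexListing (· < ·) (block2a n) L2a ∧
    IsLexListing (· < ·) (block2b n) L2b ∧
    IsLexListing (· > ·) (block2c n) L2c ∧
    IsLexListing (· < ·) (block2d k n) L2d ∧
    IsLexListing (· < ·) (block3a n) L3a ∧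
    IsLexListing (· < ·) (block3b n) L3b ∧
    L = L1 ++ L2a ++ L2b ++ L2c ++ L2d ++ L3a ++ L3b

end Anticycle

end

noncomputable section

/-! ## Linear resolutions by iterated linear syzygies -/

namespace LinearSyzygy

/-! Number the cycle `0, …, n + 2` with `x = 0`. A product of two edges, sorted as `p ≤ q ≤ r ≤ s`,
is always the product of the edges `{p, r}` and `{q, s}` (uncrossing, `exists_isGenerator`). So the
minimal generators of `I(G)²` are the quadruples satisfying `IsGenerator`, and the block of a
generator can be read off `p`, `q` and `s`.

For monomials of one degree, the colon ideals are generated by variables as soon as an exchange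
property holds: whenever `m'` precedes `m`, some variable `v` has larger exponent in `m'` than in
`m`, and `v m` is divisible by a generator preceding `m` (`colon_monomialIdeal`). The combinatorial
core `exists_reach` proves this according to the exponent of `x` in `m`.

If `x` does not divide `m`, the first entry in which `m` and `m'` differ is exchanged. If `m = x a b
c`, replacing `x` by `v` gives an element of `J²` except for a few `v` close to `a, b, c`; an `m'`
supported on the exceptional vertices is handled by an exchange among `a, b, c`. The critical pair
is `x a (a+1) (a+2)` against `a² (a+2)²`: the middle vertex must move to `a` or `a + 2`. For `a =
z₁` it cannot move down, since `x z₁² y₂` is not a generator, so `x z₁ y₂²` has to precede `x z₁ y₁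
y₂`; this is why block (2c) runs in the opposite direction. If `x²` divides `m`, one `x` is replaced
by `v`. Here `x² y₁²` comes last because the exchange with `x z₁ y₁ y₂` is only possible through `x²
y₁ y₂`.

The linear resolution uses only linear quotients and equal degrees. Adding a generator `f` to an
ideal `I` adds the relation module `I : f`, an ideal of variables, and an extension of modules with
linear syzygies again has linear syzygies (`linearStep_extension`). Since resolutions are infinite
objects, "all iterated syzygies are linear" is phrased coinductively in `IsLinear`. -/

/-- The relations satisfied by the vectors `h` modulo the submodule `N`. -/
def relations {R : Type*} [CommRing R] {s t : ℕ} (h : Fin s → Fin t → R)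
    (N : Submodule R (Fin t → R)) : Submodule R (Fin s → R) :=
  N.comap (Fintype.linearCombination R h)

theorem mem_relations {R : Type*} [CommRing R] {s t : ℕ} {h : Fin s → Fin t → R}
    {N : Submodule R (Fin t → R)} {v : Fin s → R} :
    v ∈ relations h N ↔ ∑ i, v i • h i ∈ N := by
  simp [relations, Fintype.linearCombination_apply]

theorem mem_span_range {R : Type*} [CommRing R] {s t : ℕ} {h : Fin s → Fin t → R}
    {x : Fin t → R} :
    x ∈ Submodule.span R (Set.range h) ↔ ∃ v : Fin s → R, ∑ i, v i • h i = x := by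
  rw [← Fintype.range_linearCombination, LinearMap.mem_range]
  simp [Fintype.linearCombination_apply]

/-- The inclusion of `R ^ s` as the first factor of `R ^ (s + t)`. -/
def inclLeft (R : Type*) [CommRing R] (s t : ℕ) : (Fin s → R) →ₗ[R] (Fin (s + t) → R) where
  toFun u := Fin.append u 0
  map_add' u v := by
    ext i; refine Fin.addCases (fun i => ?_) (fun i => ?_) i <;> simp
  map_smul' c u := by
    ext i; refine Fin.addCases (fun i => ?_) (fun i => ?_) i <;> simp

theorem sum_append_smul {R : Type*} [CommRing R] {a b t : ℕ} (v : Fin (a + b) → R)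
    (g : Fin a → Fin t → R) (h : Fin b → Fin t → R) :
    ∑ i, v i • Fin.append g h i =
      ∑ i, v (Fin.castAdd b i) • g i + ∑ i, v (Fin.natAdd a i) • h i := by
  simp [Fin.sum_univ_add]

section Homogeneous

variable {k : Type*} [Field k] {V : Type*}

theorem homogeneousComponent_mul_of_isHomogeneous {e : ℕ} (i : ℕ) (a : MvPolynomial V k)
    {g : MvPolynomial V k} (hg : g.IsHomogeneous e) :
    homogeneousComponent (i + e) (a * g) = homogeneousComponent i a * g := by
  conv_lhs => rw [← sum_homogeneousComponent a, Finset.sum_mul, map_sum]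
  have key : ∀ j, homogeneousComponent (i + e) (homogeneousComponent j a * g) =
      if i = j then homogeneousComponent j a * g else 0 := by
    intro j
    rw [homogeneousComponent_of_mem
      (((homogeneousComponent_isHomogeneous j a).mul hg : IsHomogeneous _ (j + e)))]
    simp
  simp only [key, Finset.sum_ite_eq, Finset.mem_range]
  split_ifs with h
  · rfl
  · rw [homogeneousComponent_eq_zero _ _ (by omega), zero_mul]

/-- `N` is generated by homogeneous elements of degree `e` whose syzygy module satisfies `C`. -/
def LinearStep (C : ∀ t : ℕ, Submodule (MvPolynomial V k) (Fin t → MvPolynomial V k) → Prop)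
    (e : ℕ) {t : ℕ} (N : Submodule (MvPolynomial V k) (Fin t → MvPolynomial V k)) : Prop :=
  ∃ (s : ℕ) (g : Fin s → Fin t → MvPolynomial V k), (∀ q p, (g q p).IsHomogeneous e) ∧
    Submodule.span _ (Set.range g) = N ∧ C s (relations g ⊥)

/-- `N` is generated by vectors of linear forms, and so are all its iterated syzygy modules. -/
def IsLinear (t : ℕ) (N : Submodule (MvPolynomial V k) (Fin t → MvPolynomial V k)) : Prop :=
  ∃ C : ∀ t : ℕ, Submodule (MvPolynomial V k) (Fin t → MvPolynomial V k) → Prop,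
    (∀ t N, C t N → LinearStep C 1 N) ∧ C t N

theorem LinearStep.mono
    {C D : ∀ t : ℕ, Submodule (MvPolynomial V k) (Fin t → MvPolynomial V k) → Prop}
    (hCD : ∀ t N, C t N → D t N) {e t : ℕ}
    {N : Submodule (MvPolynomial V k) (Fin t → MvPolynomial V k)}
    (h : LinearStep C e N) : LinearStep D e N := by
  obtain ⟨s, g, hg, hN, hC⟩ := h
  exact ⟨s, g, hg, hN, hCD _ _ hC⟩

theorem IsLinear.step {t : ℕ} {N : Submodule (MvPolynomial V k) (Fin t → MvPolynomial V k)}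
    (h : IsLinear t N) : LinearStep IsLinear 1 N := by
  obtain ⟨C, hC, hN⟩ := h
  exact (hC t N hN).mono fun t N hN => ⟨C, hC, hN⟩

/-- Coinduction: the class of modules with one linear step into `IsLinear` contains `IsLinear`,
hence is itself closed under taking syzygies. -/
theorem IsLinear.of_step {t : ℕ} {N : Submodule (MvPolynomial V k) (Fin t → MvPolynomial V k)}
    (h : LinearStep IsLinear 1 N) : IsLinear t N := by
  refine ⟨fun t N => LinearStep IsLinear 1 N, fun t N hN => hN.mono fun _ _ h => h.step, h⟩

theorem linearStep_bot (e t : ℕ) :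
    LinearStep (k := k) (V := V) IsLinear e
      (⊥ : Submodule (MvPolynomial V k) (Fin t → MvPolynomial V k)) := by
  have key : ∀ C : ∀ t : ℕ, Submodule (MvPolynomial V k) (Fin t → MvPolynomial V k) → Prop,
      C 0 ⊥ → ∀ e t, LinearStep C e
        (⊥ : Submodule (MvPolynomial V k) (Fin t → MvPolynomial V k)) := by
    intro C hC e t
    refine ⟨0, fun q => q.elim0, fun q => q.elim0, ?_, ?_⟩
    · simp
    · rwa [Subsingleton.elim (relations _ _) ⊥]
  refine key _ ⟨fun t N => N = ⊥, ?_, rfl⟩ e t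
  rintro t N rfl
  exact key (fun t N => N = ⊥) rfl 1 t

theorem isLinear_bot (t : ℕ) :
    IsLinear t (⊥ : Submodule (MvPolynomial V k) (Fin t → MvPolynomial V k)) :=
  .of_step (linearStep_bot 1 t)

/-- An injection preserves the relations between generators, so only the ambient free module
changes. -/
theorem IsLinear.map_inclLeft {s : ℕ}
    {N : Submodule (MvPolynomial V k) (Fin s → MvPolynomial V k)} (h : IsLinear s N) (t : ℕ) :
    IsLinear (s + t) (N.map (inclLeft (MvPolynomial V k) s t)) := by
  obtain ⟨a, g, hg, hN, hC⟩ := h.step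
  refine .of_step ⟨a, fun i => inclLeft _ s t (g i), ?_, ?_, ?_⟩
  · intro q p
    refine Fin.addCases (fun i => ?_) (fun i => ?_) p
    · simpa [inclLeft] using hg q i
    · simpa [inclLeft] using isHomogeneous_zero V k 1
  · rw [← hN, Submodule.map_span, ← Set.range_comp]; rfl
  · convert hC using 1
    ext v
    have hinj : Function.Injective (inclLeft (MvPolynomial V k) s t) := by
      intro u v huv
      funext i
      simpa [inclLeft] using congrFun huv (Fin.castAdd t i)
    simp only [mem_relations, Submodule.mem_bot]
    simp_rw [← map_smul, ← map_sum]
    rw [map_eq_zero_iff _ hinj]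

/-- `N` is an extension of modules with linear syzygies. -/
def IsLinearExtension (t : ℕ)
    (N : Submodule (MvPolynomial V k) (Fin t → MvPolynomial V k)) : Prop :=
  ∃ (N' : Submodule (MvPolynomial V k) (Fin t → MvPolynomial V k)) (s : ℕ)
    (h : Fin s → Fin t → MvPolynomial V k), IsLinear t N' ∧ (∀ q p, (h q p).IsHomogeneous 1) ∧
    N = N' ⊔ Submodule.span _ (Set.range h) ∧ IsLinear s (relations h N')

/-- A homogeneous relation of `h` modulo the span of `g` lifts to a homogeneous relation. -/
theorem exists_homogeneous_lift {e a s t : ℕ} {g : Fin a → Fin t → MvPolynomial V k}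
    {h : Fin s → Fin t → MvPolynomial V k} (hg : ∀ q p, (g q p).IsHomogeneous e)
    (hh : ∀ q p, (h q p).IsHomogeneous e) {v : Fin s → MvPolynomial V k}
    (hv : ∀ i, (v i).IsHomogeneous 1)
    (hmem : v ∈ relations h (Submodule.span _ (Set.range g))) :
    ∃ u : Fin a → MvPolynomial V k, (∀ i, (u i).IsHomogeneous 1) ∧
      ∑ i, u i • g i + ∑ i, v i • h i = 0 := by
  obtain ⟨b, hb⟩ := mem_span_range.1 (mem_relations.1 hmem)
  -- The relation to be lifted is homogeneous of degree `1 + e`, so keeping only the linear part of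
  -- each coefficient preserves it.
  refine ⟨fun i => - homogeneousComponent 1 (b i),
    fun i => (homogeneousComponent_isHomogeneous 1 (b i)).neg, ?_⟩
  funext c
  have hc := congrArg (homogeneousComponent (1 + e)) (congrFun hb c)
  simp only [Finset.sum_apply, Pi.smul_apply, smul_eq_mul, map_sum] at hc
  simp_rw [homogeneousComponent_mul_of_isHomogeneous 1 _ (hg _ c),
    homogeneousComponent_mul_of_isHomogeneous 1 _ (hh _ c)] at hc
  have hv' : ∀ i, homogeneousComponent 1 (v i) = v i := fun i => by
    rw [homogeneousComponent_of_mem (hv i : _ ∈ homogeneousSubmodule V k 1)]; simp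
  simp only [hv'] at hc
  simp [Finset.sum_apply, ← hc]

/-- Horseshoe argument: the syzygies of the joint generators `g, h` are the syzygies of `g` extended
by lifts of the generators `q` of the relations of `h` modulo `N'`. The syzygy module is thus again
an extension, now in degree one. -/
theorem linearStep_extension {e s t : ℕ}
    {N' : Submodule (MvPolynomial V k) (Fin t → MvPolynomial V k)}
    (hN' : LinearStep IsLinear e N') {h : Fin s → Fin t → MvPolynomial V k}
    (hh : ∀ q p, (h q p).IsHomogeneous e) (hrel : IsLinear s (relations h N')) :
    LinearStep IsLinearExtension e (N' ⊔ Submodule.span _ (Set.range h)) := by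
  obtain ⟨a, g, hg, rfl, hC⟩ := hN'
  obtain ⟨w, q, hq, hqspan, hqC⟩ := hrel.step
  have hqmem : ∀ j, q j ∈ relations h (Submodule.span _ (Set.range g)) := fun j => by
    rw [← hqspan]; exact Submodule.subset_span ⟨j, rfl⟩
  choose u hu hsyz using fun j => exists_homogeneous_lift hg hh (hq j) (hqmem j)
  have hL : ∀ (b : Fin w → MvPolynomial V k) (i : Fin a),
      (∑ j, b j • Fin.append (u j) (q j)) (Fin.castAdd s i) = (∑ j, b j • u j) i := by
    intro b i; simp
  have hR : ∀ (b : Fin w → MvPolynomial V k) (i : Fin s),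
      (∑ j, b j • Fin.append (u j) (q j)) (Fin.natAdd a i) = (∑ j, b j • q j) i := by
    intro b i; simp
  have hmem : ∀ j, Fin.append (u j) (q j) ∈ relations (Fin.append g h) ⊥ := by
    intro j
    rw [mem_relations, sum_append_smul]
    simpa using hsyz j
  have hincl : ∀ x : Fin a → MvPolynomial V k,
      inclLeft _ a s x ∈ relations (Fin.append g h) ⊥ ↔ x ∈ relations g ⊥ := by
    intro x
    simp [mem_relations, sum_append_smul, inclLeft]
  have heq : ∀ v : Fin (a + s) → MvPolynomial V k, (∀ i, v (Fin.natAdd a i) = 0) →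
      inclLeft _ a s (fun i => v (Fin.castAdd s i)) = v := by
    intro v hv
    funext i
    refine Fin.addCases (fun i => ?_) (fun i => ?_) i <;> simp [inclLeft, hv]
  refine ⟨a + s, Fin.append g h, ?_, ?_, (relations g ⊥).map (inclLeft _ a s), w,
    fun j => Fin.append (u j) (q j), hC.map_inclLeft s, ?_, ?_, ?_⟩
  · intro i
    refine Fin.addCases (fun i => ?_) (fun i => ?_) i <;> simpa using by first | exact hg i | exact hh i
  · rw [← Submodule.span_union]
    congr 1
    ext x
    simp only [Set.mem_range, Set.mem_union]
    constructor
    · rintro ⟨i, rfl⟩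
      refine Fin.addCases (fun i => ?_) (fun i => ?_) i
      · exact Or.inl ⟨i, by simp⟩
      · exact Or.inr ⟨i, by simp⟩
    · rintro (⟨i, rfl⟩ | ⟨i, rfl⟩)
      · exact ⟨Fin.castAdd s i, by simp⟩
      · exact ⟨Fin.natAdd a i, by simp⟩
  · intro j i
    refine Fin.addCases (fun i => ?_) (fun i => ?_) i
    · simpa using hu j i
    · simpa using hq j i
  · apply le_antisymm
    · intro v hv
      have hv' := hv
      rw [mem_relations, sum_append_smul, Submodule.mem_bot] at hv'
      have hvQ : (fun i => v (Fin.natAdd a i)) ∈ relations h (Submodule.span _ (Set.range g)) := by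
        rw [mem_relations, eq_neg_of_add_eq_zero_right hv']
        exact Submodule.neg_mem _ (mem_span_range.2 ⟨_, rfl⟩)
      rw [← hqspan] at hvQ
      obtain ⟨b, hb⟩ := mem_span_range.1 hvQ
      -- Subtracting a combination of lifts kills the coordinates along `h`; what remains is a
      -- syzygy of `g` alone.
      rw [← sub_add_cancel v (∑ j, b j • Fin.append (u j) (q j))]
      refine Submodule.add_mem_sup ?_ (mem_span_range.2 ⟨b, rfl⟩)
      have h0 := heq (v - ∑ j, b j • Fin.append (u j) (q j)) (fun i => by
        rw [Pi.sub_apply, hR, hb]; simp)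
      refine ⟨_, ?_, h0⟩
      rw [SetLike.mem_coe, ← hincl, h0]
      exact Submodule.sub_mem _ hv
        (Submodule.sum_mem _ fun j _ => Submodule.smul_mem _ _ (hmem j))
    · refine sup_le ?_ (Submodule.span_le.2 ?_)
      · rintro _ ⟨x, hx, rfl⟩
        exact (hincl x).2 hx
      · rintro _ ⟨j, rfl⟩
        exact hmem j
  -- A combination of the lifts falls into the first factor exactly when the same combination of the
  -- `q j` vanishes.
  · convert hqC using 1
    ext b
    rw [mem_relations, mem_relations, Submodule.mem_bot]
    constructor
    · rintro ⟨x, -, hx⟩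
      funext i
      rw [← hR, ← hx]
      simp [inclLeft]
    · intro hb
      have h0 := heq (∑ j, b j • Fin.append (u j) (q j)) (fun i => by rw [hR, hb]; rfl)
      refine ⟨_, ?_, h0⟩
      rw [SetLike.mem_coe, ← hincl, h0]
      exact Submodule.sum_mem _ fun j _ => Submodule.smul_mem _ _ (hmem j)

/-- The class of extensions is closed under taking syzygies, so it can serve as the class required
by `IsLinear`. -/
theorem IsLinearExtension.isLinear {t : ℕ}
    {N : Submodule (MvPolynomial V k) (Fin t → MvPolynomial V k)}
    (h : IsLinearExtension t N) : IsLinear t N := by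
  refine ⟨IsLinearExtension, ?_, h⟩
  rintro t N ⟨N', s, h, hN', hh, rfl, hrel⟩
  exact linearStep_extension hN'.step hh hrel

theorem LinearStep.sup_span {e s t : ℕ}
    {N' : Submodule (MvPolynomial V k) (Fin t → MvPolynomial V k)}
    (hN' : LinearStep IsLinear e N') {h : Fin s → Fin t → MvPolynomial V k}
    (hh : ∀ q p, (h q p).IsHomogeneous e) (hrel : IsLinear s (relations h N')) :
    LinearStep IsLinear e (N' ⊔ Submodule.span _ (Set.range h)) :=
  (linearStep_extension hN' hh hrel).mono fun _ _ h => h.isLinear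

/-! ### From linear quotients to linear resolutions -/

/-- An ideal, as a submodule of the free module of rank one. -/
def ofIdeal {R : Type*} [CommRing R] (I : Ideal R) : Submodule R (Fin 1 → R) :=
  Submodule.comap (LinearMap.proj 0) I

theorem mem_ofIdeal {R : Type*} [CommRing R] {I : Ideal R} {v : Fin 1 → R} :
    v ∈ ofIdeal I ↔ v 0 ∈ I := Iff.rfl

/-- The relations of the single element `f` modulo `I` are precisely the colon ideal `I : f`. -/
theorem LinearStep.ofIdeal_sup_span {e : ℕ} {I Q : Ideal (MvPolynomial V k)}
    (hI : LinearStep IsLinear e (ofIdeal I)) {f : MvPolynomial V k} (hf : f.IsHomogeneous e)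
    (hQ : I.colon {f} = Q) (hQlin : IsLinear 1 (ofIdeal Q)) :
    LinearStep IsLinear e (ofIdeal (I ⊔ Ideal.span {f})) := by
  have h := hI.sup_span (h := fun _ : Fin 1 => fun _ : Fin 1 => f) (fun _ _ => hf) (by
    convert hQlin using 1
    ext v
    rw [mem_relations, mem_ofIdeal, mem_ofIdeal, ← hQ, Submodule.mem_colon_singleton]
    simp)
  convert h using 1
  ext v
  rw [mem_ofIdeal, Submodule.mem_sup, Submodule.mem_sup]
  constructor
  · rintro ⟨a, ha, b, hb, hab⟩
    obtain ⟨c, rfl⟩ := Ideal.mem_span_singleton'.1 hb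
    refine ⟨fun _ => a, ha, fun _ => c * f, mem_span_range.2 ⟨fun _ => c, ?_⟩, ?_⟩
    · funext i; simp
    · funext i; rw [Subsingleton.elim i 0, ← hab]; rfl
  · rintro ⟨a, ha, b, hb, rfl⟩
    obtain ⟨c, rfl⟩ := mem_span_range.1 hb
    exact ⟨a 0, ha, _, Ideal.mem_span_singleton'.2 ⟨c 0, rfl⟩, by simp⟩

theorem colon_span_X {S : Set V} {a : V} (ha : a ∉ S) :
    (Ideal.span ((fun v => (X v : MvPolynomial V k)) '' S)).colon {X a} =
      Ideal.span ((fun v => (X v : MvPolynomial V k)) '' S) := by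
  ext f
  rw [Submodule.mem_colon_singleton, smul_eq_mul, mem_ideal_span_X_image, mem_ideal_span_X_image]
  simp only [support_mul_X, Finset.mem_map, addRightEmbedding_apply, forall_exists_index, and_imp,
    forall_apply_eq_imp_iff₂]
  refine forall₂_congr fun m _ => exists_congr fun i => and_congr_right fun hi => ?_
  have : a ≠ i := fun h => ha (h ▸ hi)
  simp [this]

/-- The Koszul case: variables are added one at a time, and a new variable is a nonzerodivisor
modulo the previous ones, so the colon ideal is the ideal already treated. -/
theorem isLinear_span_X {S : Set V} (hS : S.Finite) :
    IsLinear 1 (ofIdeal (Ideal.span ((fun v => (X v : MvPolynomial V k)) '' S))) := by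
  induction S, hS using Set.Finite.induction_on with
  | empty =>
    convert isLinear_bot (k := k) (V := V) 1 using 1
    ext v
    simp [mem_ofIdeal, _root_.funext_iff, Fin.forall_fin_one]
  | @insert a S ha _ ih =>
    rw [Set.image_insert_eq, Ideal.span_insert, sup_comm]
    exact .of_step (ih.step.ofIdeal_sup_span (isHomogeneous_X k a) (colon_span_X ha) ih)

theorem linearStep_of_isLinearQuotientsOrdering [Finite V] {I : Ideal (MvPolynomial V k)}
    {L : List (V →₀ ℕ)} (hL : IsLinearQuotientsOrdering I L) {e : ℕ}
    (he : ∀ m ∈ L, m.degree = e) : LinearStep IsLinear e (ofIdeal I) := by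
  have key : ∀ i ≤ L.length,
      LinearStep IsLinear e (ofIdeal (monomialIdeal k {m | m ∈ L.take i})) := by
    intro i
    induction i with
    | zero =>
      intro _
      convert linearStep_bot (k := k) (V := V) e 1 using 1
      ext v
      simp [mem_ofIdeal, monomialIdeal, _root_.funext_iff, Fin.forall_fin_one]
    | succ i ih =>
      intro hi
      have hset : monomialIdeal k {m | m ∈ L.take (i + 1)} =
          monomialIdeal k {m | m ∈ L.take i} ⊔ Ideal.span {monomial L[i] (1 : k)} := by
        rw [monomialIdeal, monomialIdeal, ← Ideal.span_union,
          ← Set.image_singleton (f := fun m => monomial m (1 : k)), ← Set.image_union]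
        congr 2
        ext m
        simp only [Set.mem_union, Set.mem_ofPred_eq, List.take_succ_eq_append_getElem hi,
          List.mem_append, List.mem_singleton, Set.mem_singleton_iff]
      rw [hset]
      have hhom : (monomial L[i] (1 : k)).IsHomogeneous e :=
        isHomogeneous_monomial _ (he _ (List.getElem_mem _))
      rcases Nat.eq_zero_or_pos i with rfl | hpos
      -- `colon_eq` says nothing about the first monomial; there the colon of the zero ideal by a
      -- nonzero element is zero.
      · refine (ih (by omega)).ofIdeal_sup_span hhom rfl ?_
        convert isLinear_bot (k := k) (V := V) 1 using 1
        ext v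
        simp [mem_ofIdeal, monomialIdeal, _root_.funext_iff, Fin.forall_fin_one,
          Submodule.mem_colon_singleton]
      · obtain ⟨S, hS⟩ := hL.colon_eq i hi hpos
        exact (ih (by omega)).ofIdeal_sup_span hhom hS (isLinear_span_X S.toFinite)
  have := key L.length le_rfl
  rwa [List.take_length, hL.span_eq] at this

/-- Choosing generators for each successive syzygy module gives the resolution. Its differentials
consist of linear forms, which makes it minimal. -/
theorem LinearStep.hasLinearResolution {I : Ideal (MvPolynomial V k)} {e : ℕ}
    (h : LinearStep IsLinear e (ofIdeal I)) : HasLinearResolution I e := by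
  obtain ⟨s, g, hg, hspan, hlin⟩ := h
  choose rk gens hgens hgspan hgrel using
    fun T : Σ t : ℕ, {N : Submodule (MvPolynomial V k) (Fin t → MvPolynomial V k) //
      IsLinear t N} => T.2.2.step
  let st : ℕ → Σ t : ℕ, {N : Submodule (MvPolynomial V k) (Fin t → MvPolynomial V k) //
      IsLinear t N} := fun i => Nat.rec ⟨s, _, hlin⟩ (fun _ T => ⟨rk T, _, hgrel T⟩) i
  have hmv : ∀ (i : ℕ) (v : Fin (rk (st i)) → MvPolynomial V k),
      (Matrix.of fun p q => gens (st i) q p).mulVec v = ∑ q, v q • gens (st i) q := by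
    intro i v
    funext p
    simp [Matrix.mulVec, dotProduct, mul_comm]
  have hex : ∀ (i : ℕ) (v : Fin (st i).1 → MvPolynomial V k), v ∈ (st i).2.1 ↔
      ∃ w, (Matrix.of fun p q => gens (st i) q p).mulVec w = v := by
    intro i v
    simp_rw [hmv]
    rw [← mem_span_range, hgspan]
  refine ⟨{ rank := fun i => (st i).1
            deg := fun i _ => i + e
            gen := fun p => g p 0
            d := fun i => Matrix.of fun p q => gens (st i) q p
            gen_homogeneous := fun p => by simpa using hg p 0
            d_homogeneous := fun i p q => Or.inr ⟨1, by ring, hgens (st i) q p⟩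
            minimal := fun i p q => ?_
            gen_span := ?_
            exact_zero := fun v => ?_
            exact_succ := fun i v => ?_ }, fun i j hj => ?_⟩
  · have := hgens (st i) q p
    exact this.coeff_eq_zero (by simp)
  · ext f
    have : f ∈ I ↔ (fun _ => f) ∈ ofIdeal I := Iff.rfl
    rw [this, ← hspan, mem_span_range, Ideal.mem_span_range_iff_exists_fun]
    refine exists_congr fun c => ?_
    simp only [_root_.funext_iff, Fin.forall_fin_one, Finset.sum_apply, Pi.smul_apply, smul_eq_mul]
    rfl
  · rw [← hex 0 v]
    change _ ↔ v ∈ relations g ⊥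
    rw [mem_relations, Submodule.mem_bot]
    simp only [_root_.funext_iff, Fin.forall_fin_one, Finset.sum_apply, Pi.smul_apply, smul_eq_mul]
    rfl
  · rw [← hex (i + 1) v]
    change _ ↔ v ∈ relations (gens (st i)) ⊥
    rw [mem_relations, Submodule.mem_bot, ← hmv]
  · rw [MinimalGradedFreeResolution.betti, Nat.card_eq_zero]
    exact Or.inl ⟨fun p => hj p.2.symm⟩

end Homogeneous

end LinearSyzygy

theorem IsLinearQuotientsOrdering.hasLinearResolution {k : Type*} [Field k] {V : Type*} [Finite V]
    {I : Ideal (MvPolynomial V k)} {L : List (V →₀ ℕ)} (hL : IsLinearQuotientsOrdering I L)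
    {e : ℕ} (he : ∀ m ∈ L, m.degree = e) : HasLinearResolution I e :=
  (LinearSyzygy.linearStep_of_isLinearQuotientsOrdering hL he).hasLinearResolution

end

/-! ## The order on the generators, in terms of sorted quadruples of vertices -/

namespace Quadruple

/-- The multiplicity of `v` in the quadruple `p, q, r, s`. -/
def count (p q r s v : ℕ) : ℕ :=
  (if p = v then 1 else 0) + (if q = v then 1 else 0) + (if r = v then 1 else 0) +
    (if s = v then 1 else 0)

/-- The quadruple `p ≤ q ≤ r ≤ s` is the product of the edges `{p, r}` and `{q, s}` of the
anticycle on `n + 3` vertices. -/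
def IsGenerator (n p q r s : ℕ) : Prop :=
  p ≤ q ∧ q ≤ r ∧ r ≤ s ∧ s ≤ n + 2 ∧ p + 2 ≤ r ∧ q + 2 ≤ s ∧ (p = 0 → r ≤ n + 1) ∧
    (q = 0 → s ≤ n + 1)

/-- The number of the block containing the quadruple. -/
def block (n p q _r s : ℕ) : ℕ :=
  if 1 ≤ p then 1
  else if 1 ≤ q then
    if q = 1 then if s = n + 2 then 2 else 4 else if s = n + 2 then 3 else 5
  else if s = 2 then 7 else 6

/-- Lexicographic order of quadruples. -/
def LexLT (p' q' r' s' p q r s : ℕ) : Prop :=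
  p' < p ∨ p' = p ∧ (q' < q ∨ q' = q ∧ (r' < r ∨ r' = r ∧ s' < s))

/-- The order of the generators; the block `ρ` and the fourth block are listed in
lexicographic order starting with the largest vertex. -/
def Before (n ρ p' q' r' s' p q r s : ℕ) : Prop :=
  block n p' q' r' s' < block n p q r s ∨
    block n p' q' r' s' = block n p q r s ∧
      ((block n p q r s = ρ ∨ block n p q r s = 4) ∧ LexLT s r q p s' r' q' p' ∨
        ¬ (block n p q r s = ρ ∨ block n p q r s = 4) ∧ LexLT p' q' r' s' p q r s)

/-- Some earlier generator arises from the quadruple by replacing an element by `v`. -/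
def Reach (n ρ p q r s v : ℕ) : Prop :=
  ∃ p₁ q₁ r₁ s₁ w, IsGenerator n p₁ q₁ r₁ s₁ ∧ Before n ρ p₁ q₁ r₁ s₁ p q r s ∧
    ∀ u, count p₁ q₁ r₁ s₁ u + (if w = u then 1 else 0) =
      count p q r s u + (if v = u then 1 else 0)

theorem mem_of_count_le {p' q' r' s' p q r s u : ℕ}
    (h : count p' q' r' s' u ≤ count p q r s u) (hu : u = p' ∨ u = q' ∨ u = r' ∨ u = s') :
    u = p ∨ u = q ∨ u = r ∨ u = s := by
  unfold count at h
  rcases hu with rfl | rfl | rfl | rfl <;> by_contra! hc <;>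
    simp [hc.1.symm, hc.2.1.symm, hc.2.2.1.symm, hc.2.2.2.symm] at h

theorem not_double_of_count_le {p' q' r' s' p q r s u : ℕ}
    (h : count p' q' r' s' u ≤ count p q r s u) (hu : count p q r s u ≤ 1) :
    ¬ (p' = u ∧ q' = u) ∧ ¬ (q' = u ∧ r' = u) ∧ ¬ (r' = u ∧ s' = u) := by
  unfold count at h hu
  refine ⟨?_, ?_, ?_⟩ <;> rintro ⟨rfl, rfl⟩ <;> simp at h <;> omega

/-- Divisibility between monomials of the same degree is equality, and sorting makes the quadruple
unique. -/
theorem eq_of_count_le {p' q' r' s' p q r s : ℕ} (h1 : p ≤ q) (h2 : q ≤ r) (h3 : r ≤ s)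
    (h1' : p' ≤ q') (h2' : q' ≤ r') (h3' : r' ≤ s')
    (h : ∀ u, count p' q' r' s' u ≤ count p q r s u) :
    p' = p ∧ q' = q ∧ r' = r ∧ s' = s := by
  have hc : ∀ a b c d u : ℕ, List.count u [a, b, c, d] = count a b c d u := by
    intro a b c d u
    simp [count, List.count_cons]
    ring
  have hle : (↑[p', q', r', s'] : Multiset ℕ) ≤ ↑[p, q, r, s] := by
    rw [Multiset.le_iff_count]
    intro u
    simpa only [Multiset.coe_count, hc] using h u
  have heq := Multiset.eq_of_le_of_card_le hle (by simp)
  have hperm := Multiset.coe_eq_coe.1 heq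
  have := hperm.eq_of_pairwise (le := (· ≤ ·)) (fun a b _ _ => le_antisymm)
    (by simp; omega) (by simp; omega)
  simpa using this

/-! ### Exchange property for generators prime to `x` -/

variable {n ρ p' q' r' s' p q r s a b c v : ℕ}

/-- The first differing entry, read from the end that the lex order favours, is replaced by the
entry of the earlier quadruple. The distance conditions survive because the new entry moves away
from its partner, or the partner already agrees with that of the earlier quadruple. -/
theorem exists_reach_of_one_le (hg : IsGenerator n p q r s) (hg' : IsGenerator n p' q' r' s')
    (hb : Before n ρ p' q' r' s' p q r s) (hp : 1 ≤ p) :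
    ∃ v, Reach n ρ p q r s v ∧ count p q r s v < count p' q' r' s' v := by
  have hblk : block n p q r s = 1 := by simp [block, hp]
  have hblk' : block n p' q' r' s' = 1 := by
    have : block n p' q' r' s' ≤ 1 := by
      unfold Before at hb; omega
    unfold block at this ⊢
    split_ifs at this ⊢ <;> omega
  have hp' : 1 ≤ p' := by
    unfold block at hblk'; split_ifs at hblk' <;> omega
  unfold IsGenerator at hg hg'
  simp only [Before, hblk, hblk', lt_irrefl, false_or, true_and] at hb
  have key : ∀ p₁ q₁ r₁ s₁ w v, IsGenerator n p₁ q₁ r₁ s₁ →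
      (∀ u, count p₁ q₁ r₁ s₁ u + (if w = u then 1 else 0) =
        count p q r s u + (if v = u then 1 else 0)) → 1 ≤ p₁ →
      ((1 = ρ ∨ 1 = 4) ∧ LexLT s r q p s₁ r₁ q₁ p₁ ∨
        ¬ (1 = ρ ∨ 1 = 4) ∧ LexLT p₁ q₁ r₁ s₁ p q r s) → Reach n ρ p q r s v := by
    intro p₁ q₁ r₁ s₁ w v h1 h2 h3 h4
    have : block n p₁ q₁ r₁ s₁ = 1 := by simp [block, h3]
    refine ⟨p₁, q₁, r₁, s₁, w, h1, Or.inr ⟨by rw [this, hblk], ?_⟩, h2⟩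
    rwa [hblk]
  by_cases hρ : 1 = ρ
  · have hb' : LexLT s r q p s' r' q' p' := by
      rcases hb with hb | hb
      · exact hb.2
      · exact absurd (Or.inl hρ) hb.1
    unfold LexLT at hb'
    rcases hb' with h | ⟨rfl, h | ⟨rfl, h | ⟨rfl, h⟩⟩⟩
    · refine ⟨s', key p q r s' s s' ?_ ?_ ?_ ?_, ?_⟩
      · unfold IsGenerator; omega
      · intro u; unfold count; ring
      · omega
      · unfold LexLT; omega
      · unfold count; split_ifs <;> omega
    · refine ⟨r', key p q r' s r r' ?_ ?_ ?_ ?_, ?_⟩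
      · unfold IsGenerator; omega
      · intro u; unfold count; ring
      · omega
      · unfold LexLT; omega
      · unfold count; split_ifs <;> omega
    · refine ⟨q', key p q' r s q q' ?_ ?_ ?_ ?_, ?_⟩
      · unfold IsGenerator; omega
      · intro u; unfold count; ring
      · omega
      · unfold LexLT; omega
      · unfold count; split_ifs <;> omega
    · refine ⟨p', key p' q r s p p' ?_ ?_ ?_ ?_, ?_⟩
      · unfold IsGenerator; omega
      · intro u; unfold count; ring
      · omega
      · unfold LexLT; omega
      · unfold count; split_ifs <;> omega
  · have hb' : LexLT p' q' r' s' p q r s := by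
      rcases hb with hb | hb
      · omega
      · exact hb.2
    unfold LexLT at hb'
    rcases hb' with h | ⟨rfl, h | ⟨rfl, h | ⟨rfl, h⟩⟩⟩
    · refine ⟨p', key p' q r s p p' ?_ ?_ ?_ ?_, ?_⟩
      · unfold IsGenerator; omega
      · intro u; unfold count; ring
      · omega
      · unfold LexLT; omega
      · unfold count; split_ifs <;> omega
    · refine ⟨q', key p' q' r s q q' ?_ ?_ ?_ ?_, ?_⟩
      · unfold IsGenerator; omega
      · intro u; unfold count; ring
      · omega
      · unfold LexLT; omega
      · unfold count; split_ifs <;> omega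
    · refine ⟨r', key p' q' r' s r r' ?_ ?_ ?_ ?_, ?_⟩
      · unfold IsGenerator; omega
      · intro u; unfold count; ring
      · omega
      · unfold LexLT; omega
      · unfold count; split_ifs <;> omega
    · refine ⟨s', key p' q' r' s' s s' ?_ ?_ ?_ ?_, ?_⟩
      · unfold IsGenerator; omega
      · intro u; unfold count; ring
      · omega
      · unfold LexLT; omega
      · unfold count; split_ifs <;> omega

/-! ### Exchange property for generators divisible by `x` exactly once -/

/-- Multiplying by `v` and dividing by the vertex `0`. -/
theorem reach_of_one_le_block_two (hg : IsGenerator n 0 a b c) (ha : 1 ≤ a) (hv : 1 ≤ v)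
    (hvn : v ≤ n + 2)
    (h : v + 2 ≤ b ∧ v ≤ a ∨ a ≤ v ∧ v ≤ b ∧ a + 2 ≤ b ∧ v + 2 ≤ c ∨
      b ≤ v ∧ v ≤ c ∧ a + 2 ≤ v ∧ b + 2 ≤ c ∨ c ≤ v ∧ b + 2 ≤ v) :
    Reach n ρ 0 a b c v := by
  unfold IsGenerator at hg
  have key : ∀ p₁ q₁ r₁ s₁, IsGenerator n p₁ q₁ r₁ s₁ → 1 ≤ p₁ →
      (∀ u, count p₁ q₁ r₁ s₁ u + (if 0 = u then 1 else 0) =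
        count 0 a b c u + (if v = u then 1 else 0)) → Reach n ρ 0 a b c v := by
    intro p₁ q₁ r₁ s₁ h1 h2 h3
    refine ⟨p₁, q₁, r₁, s₁, 0, h1, Or.inl ?_, h3⟩
    have : block n p₁ q₁ r₁ s₁ = 1 := by simp [block, h2]
    rw [this]
    unfold block
    split_ifs <;> omega
  rcases h with h | h | h | h
  · refine key v a b c ?_ ?_ ?_
    · unfold IsGenerator; omega
    · omega
    · intro u; unfold count; ring
  · refine key a v b c ?_ ?_ ?_
    · unfold IsGenerator; omega
    · omega
    · intro u; unfold count; ring
  · refine key a b v c ?_ ?_ ?_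
    · unfold IsGenerator; omega
    · omega
    · intro u; unfold count; ring
  · refine key a b c v ?_ ?_ ?_
    · unfold IsGenerator; omega
    · omega
    · intro u; unfold count; ring

theorem before_block_two_iff {a₁ b₁ c₁ : ℕ} (ha : 1 ≤ a) (ha₁ : 1 ≤ a₁) (hρ : ρ ≤ 1) :
    Before n ρ 0 a₁ b₁ c₁ 0 a b c ↔
      if a = 1 then
        if c = n + 2 then a₁ = 1 ∧ c₁ = n + 2 ∧ b₁ < b
        else c₁ = n + 2 ∨ a₁ = 1 ∧ (c < c₁ ∨ c = c₁ ∧ b < b₁)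
      else
        if c = n + 2 then c₁ = n + 2 ∧ (a₁ < a ∨ a₁ = a ∧ b₁ < b)
        else a₁ = 1 ∨ c₁ = n + 2 ∨ a₁ < a ∨ a₁ = a ∧ (b₁ < b ∨ b₁ = b ∧ c₁ < c) := by
  unfold Before LexLT block
  split_ifs <;> omega

end Quadruple

namespace Quadruple

variable {n ρ p' q' r' s' p q r s a b c v w : ℕ}

theorem before_block_two_cases (hρ : ρ ≤ 1) (ha : 1 ≤ a) (hb : Before n ρ p' q' r' s' 0 a b c) :
    1 ≤ p' ∨ p' = 0 ∧ 1 ≤ q' ∧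
      if a = 1 then
        if c = n + 2 then q' = 1 ∧ s' = n + 2 ∧ r' < b
        else s' = n + 2 ∨ q' = 1 ∧ (c < s' ∨ c = s' ∧ b < r')
      else
        if c = n + 2 then s' = n + 2 ∧ (q' < a ∨ q' = a ∧ r' < b)
        else q' = 1 ∨ s' = n + 2 ∨ q' < a ∨ q' = a ∧ (r' < b ∨ r' = b ∧ s' < c) := by
  rcases Nat.eq_zero_or_pos p' with rfl | h
  · rcases Nat.eq_zero_or_pos q' with rfl | h'
    · unfold Before block at hb
      split_ifs at hb <;> omega
    · exact Or.inr ⟨rfl, h', (before_block_two_iff ha h' hρ).1 hb⟩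
  · exact Or.inl h

theorem count_lt_of_replace (hvw : v ≠ w) (h : ∀ u, count p' q' r' s' u + (if w = u then 1 else 0) =
      count p q r s u + (if v = u then 1 else 0)) : count p q r s v < count p' q' r' s' v := by
  have := h v
  rw [if_neg hvw.symm, if_pos rfl] at this
  omega

theorem Reach.exists_of_replace (hg : IsGenerator n p' q' r' s')
    (hb : Before n ρ p' q' r' s' p q r s) (hvw : v ≠ w)
    (h : ∀ u, count p' q' r' s' u + (if w = u then 1 else 0) =
      count p q r s u + (if v = u then 1 else 0)) :
    ∃ v, Reach n ρ p q r s v ∧ count p q r s v < count p' q' r' s' v :=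
  ⟨v, ⟨p', q', r', s', w, hg, hb, h⟩, count_lt_of_replace hvw h⟩

theorem reach_block_two {a₁ b₁ c₁ : ℕ} (hρ : ρ ≤ 1) (ha : 1 ≤ a)
    (hg : IsGenerator n 0 a₁ b₁ c₁) (ha₁ : 1 ≤ a₁)
    (hb : if a = 1 then
        if c = n + 2 then a₁ = 1 ∧ c₁ = n + 2 ∧ b₁ < b
        else c₁ = n + 2 ∨ a₁ = 1 ∧ (c < c₁ ∨ c = c₁ ∧ b < b₁)
      else
        if c = n + 2 then c₁ = n + 2 ∧ (a₁ < a ∨ a₁ = a ∧ b₁ < b)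
        else a₁ = 1 ∨ c₁ = n + 2 ∨ a₁ < a ∨ a₁ = a ∧ (b₁ < b ∨ b₁ = b ∧ c₁ < c))
    (hc : ∀ u, count 0 a₁ b₁ c₁ u + (if w = u then 1 else 0) =
      count 0 a b c u + (if v = u then 1 else 0)) : Reach n ρ 0 a b c v :=
  ⟨0, a₁, b₁, c₁, w, hg, (before_block_two_iff ha ha₁ hρ).2 hb, hc⟩

/-- If no reachable vertex had larger multiplicity in the earlier monomial, that monomial would
divide the later one, hence equal it, which a strict order forbids. -/
theorem exists_reach_of_forall_reach (hg : IsGenerator n p q r s)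
    (hg' : IsGenerator n p' q' r' s') (hb : Before n ρ p' q' r' s' p q r s)
    (h : ∀ v, (v = p' ∨ v = q' ∨ v = r' ∨ v = s') →
      Reach n ρ p q r s v ∨ count p' q' r' s' v ≤ count p q r s v) :
    ∃ v, Reach n ρ p q r s v ∧ count p q r s v < count p' q' r' s' v := by
  by_contra! H
  unfold IsGenerator at hg hg'
  have := eq_of_count_le (p := p) (q := q) (r := r) (s := s) (p' := p') (q' := q') (r' := r')
      (s' := s') (by omega) (by omega) (by omega) (by omega) (by omega) (by omega) (fun u => by
        by_cases hu : u = p' ∨ u = q' ∨ u = r' ∨ u = s'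
        · exact (h u hu).elim (H u) id
        · have : count p' q' r' s' u = 0 := by unfold count; split_ifs <;> omega
          omega)
  obtain ⟨rfl, rfl, rfl, rfl⟩ := this
  unfold Before LexLT at hb
  omega

/-- If the first two vertices are at distance at least two and the last two are not. -/
theorem exists_reach_block_two_left (hρ : ρ ≤ 1) (hg : IsGenerator n 0 a b c)
    (hg' : IsGenerator n p' q' r' s') (hb : Before n ρ p' q' r' s' 0 a b c) (ha : 1 ≤ a)
    (h1 : a + 2 ≤ b) (h2 : ¬ b + 2 ≤ c) :
    ∃ v, Reach n ρ 0 a b c v ∧ count 0 a b c v < count p' q' r' s' v := by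
  have hb' := before_block_two_cases hρ ha hb
  by_contra! H
  have up := fun v h1 h2 h3 => H v (reach_of_one_le_block_two hg ha h1 h2 h3)
  have hg1 := hg
  have hg1' := hg'
  unfold IsGenerator at hg1 hg1'
  -- The vertex `a` is reachable, so it occurs at most once in the earlier monomial.
  have hd := not_double_of_count_le (up a ha (by omega) (by omega))
    (by unfold count; split_ifs <;> omega)
  have mem : ∀ v, (v = p' ∨ v = q' ∨ v = r' ∨ v = s') →
      v = 0 ∨ v = a ∨ c ≤ v + 1 ∧ v ≤ b + 1 := by
    intro v hv
    by_contra! hc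
    have := mem_of_count_le (up v (by omega) (by omega) (by omega)) hv
    omega
  obtain ⟨v, hv, hlt⟩ : ∃ v, Reach n ρ 0 a b c v ∧ count 0 a b c v < count p' q' r' s' v := by
    by_cases h3 : c = b
    · subst h3
      -- The direction of the block decides which neighbour of `c` is reachable: with `z₁` present
      -- large entries come first and `c` can be raised, possibly into block (2a); otherwise it can
      -- be lowered.
      by_cases h4 : a = 1
      · have mem' : ∀ v, (v = p' ∨ v = q' ∨ v = r' ∨ v = s') →
            v = 0 ∨ v = a ∨ v = c - 1 ∨ v = c := by
          intro v hv
          have h5 := mem v hv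
          by_contra! hc
          obtain rfl : v = c + 1 := by omega
          have := mem_of_count_le (H (c + 1) (reach_block_two (a₁ := a) (b₁ := c)
            (c₁ := c + 1) (w := c) hρ ha (by unfold IsGenerator; omega) ha
            (by split_ifs <;> omega) (fun u => by unfold count; ring))) hv
          omega
        have mp := mem' p' (by simp)
        have mq := mem' q' (by simp)
        have mr := mem' r' (by simp)
        have ms := mem' s' (by simp)
        clear mem mem'
        have h5 : p' = 0 ∧ q' = a := by omega
        obtain ⟨rfl, rfl⟩ := h5
        have h6 : r' = c - 1 ∧ s' = c := by
          split_ifs at hb' <;> omega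
        obtain ⟨rfl, rfl⟩ := h6
        -- The surviving candidate differs from the given monomial by one exchange, so it is its own
        -- witness.
        exact Reach.exists_of_replace (v := s' - 1) (w := s') hg' hb (by omega)
          (fun u => by unfold count; ring)
      · have mem' : ∀ v, (v = p' ∨ v = q' ∨ v = r' ∨ v = s') →
            v = 0 ∨ v = a ∨ v = c + 1 ∨ v = c := by
          intro v hv
          have h5 := mem v hv
          by_contra! hc
          obtain rfl : v = c - 1 := by omega
          have := mem_of_count_le (H (c - 1) (reach_block_two (a₁ := a) (b₁ := c - 1)
            (c₁ := c) (w := c) hρ ha (by unfold IsGenerator; omega) ha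
            (by split_ifs <;> omega) (fun u => by unfold count; ring))) hv
          omega
        have mp := mem' p' (by simp)
        have mq := mem' q' (by simp)
        have mr := mem' r' (by simp)
        have ms := mem' s' (by simp)
        clear mem mem'
        have h5 : p' = 0 ∧ q' = a := by omega
        obtain ⟨rfl, rfl⟩ := h5
        have h6 : r' = c ∧ s' = c + 1 := by
          split_ifs at hb' <;> omega
        obtain ⟨rfl, rfl⟩ := h6
        exact Reach.exists_of_replace (v := r' + 1) (w := r') hg' hb (by omega)
          (fun u => by unfold count; ring)
    · have mp := mem p' (by simp)
      have mq := mem q' (by simp)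
      have mr := mem r' (by simp)
      have ms := mem s' (by simp)
      have h5 : p' = 0 ∧ q' = a := by omega
      obtain ⟨rfl, rfl⟩ := h5
      have h6 : r' = b ∧ s' = b ∨ r' = c ∧ s' = c := by
        split_ifs at hb' <;> omega
      obtain ⟨rfl, rfl⟩ | ⟨rfl, rfl⟩ := h6
      · exact Reach.exists_of_replace (v := s') (w := c) hg' hb (by omega)
          (fun u => by unfold count; ring)
      · exact Reach.exists_of_replace (v := s') (w := b) hg' hb (by omega)
          (fun u => by unfold count; ring)
  exact absurd (H v hv) (not_le.2 hlt)

/-- If the last two vertices are at distance at least two and the first two are not. -/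
theorem exists_reach_block_two_right (hρ : ρ ≤ 1) (hg : IsGenerator n 0 a b c)
    (hg' : IsGenerator n p' q' r' s') (hb : Before n ρ p' q' r' s' 0 a b c) (ha : 1 ≤ a)
    (h1 : ¬ a + 2 ≤ b) (h2 : b + 2 ≤ c) :
    ∃ v, Reach n ρ 0 a b c v ∧ count 0 a b c v < count p' q' r' s' v := by
  have hb' := before_block_two_cases hρ ha hb
  by_contra! H
  have up := fun v h1 h2 h3 => H v (reach_of_one_le_block_two hg ha h1 h2 h3)
  have hg1 := hg
  have hg1' := hg'
  unfold IsGenerator at hg1 hg1'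
  have hd := not_double_of_count_le (up c (by omega) (by omega) (by omega))
    (by unfold count; split_ifs <;> omega)
  have mem : ∀ v, (v = p' ∨ v = q' ∨ v = r' ∨ v = s') →
      v = 0 ∨ v = c ∨ b ≤ v + 1 ∧ v ≤ a + 1 := by
    intro v hv
    by_contra! hc
    have := mem_of_count_le (up v (by omega) (by omega) (by omega)) hv
    omega
  obtain ⟨v, hv, hlt⟩ : ∃ v, Reach n ρ 0 a b c v ∧ count 0 a b c v < count p' q' r' s' v := by
    by_cases h3 : b = a
    · subst h3
      have mem' : ∀ v, (v = p' ∨ v = q' ∨ v = r' ∨ v = s') →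
          v = 0 ∨ v = c ∨ v = b ∨ v = b + 1 := by
        intro v hv
        have h5 := mem v hv
        by_contra! hc
        obtain rfl : v = b - 1 := by omega
        have := mem_of_count_le (H (b - 1) (reach_block_two (a₁ := b - 1) (b₁ := b)
          (c₁ := c) (w := b) hρ ha (by unfold IsGenerator; omega) (by omega)
          (by split_ifs <;> omega) (fun u => by unfold count; ring))) hv
        omega
      have mp := mem' p' (by simp)
      have mq := mem' q' (by simp)
      have mr := mem' r' (by simp)
      have ms := mem' s' (by simp)
      clear mem mem'
      have h5 : p' = 0 ∧ s' = c := by omega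
      obtain ⟨rfl, rfl⟩ := h5
      have h6 : q' = b ∧ r' = b + 1 := by
        split_ifs at hb' <;> omega
      obtain ⟨rfl, rfl⟩ := h6
      exact Reach.exists_of_replace (v := q' + 1) (w := q') hg' hb (by omega)
        (fun u => by unfold count; ring)
    · have mp := mem p' (by simp)
      have mq := mem q' (by simp)
      have mr := mem r' (by simp)
      have ms := mem s' (by simp)
      clear mem
      have h5 : p' = 0 ∧ s' = c := by omega
      obtain ⟨rfl, rfl⟩ := h5
      have h6 : q' = a ∧ r' = a ∨ q' = b ∧ r' = b := by
        split_ifs at hb' <;> omega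
      obtain ⟨rfl, rfl⟩ | ⟨rfl, rfl⟩ := h6
      · exact Reach.exists_of_replace (v := r') (w := b) hg' hb (by omega)
          (fun u => by unfold count; ring)
      · exact Reach.exists_of_replace (v := r') (w := a) hg' hb (by omega)
          (fun u => by unfold count; ring)
  exact absurd (H v hv) (not_le.2 hlt)

/-- If the three vertices are consecutive. -/
theorem exists_reach_block_two_consecutive (hn : 2 ≤ n) (hρ : ρ ≤ 1)
    (hg : IsGenerator n 0 a (a + 1) (a + 2)) (hg' : IsGenerator n p' q' r' s')
    (hb : Before n ρ p' q' r' s' 0 a (a + 1) (a + 2)) (ha : 1 ≤ a) :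
    ∃ v, Reach n ρ 0 a (a + 1) (a + 2) v ∧
      count 0 a (a + 1) (a + 2) v < count p' q' r' s' v := by
  have hb' := before_block_two_cases hρ ha hb
  by_contra! H
  have up := fun v h1 h2 h3 => H v (reach_of_one_le_block_two hg ha h1 h2 h3)
  have hg1 := hg
  have hg1' := hg'
  unfold IsGenerator at hg1 hg1'
  have mem : ∀ v, (v = p' ∨ v = q' ∨ v = r' ∨ v = s') → v = 0 ∨ a ≤ v ∧ v ≤ a + 2 := by
    intro v hv
    by_contra! hc
    have := mem_of_count_le (up v (by omega) (by omega) (by omega)) hv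
    omega
  have mp := mem p' (by simp)
  have mq := mem q' (by simp)
  have mr := mem r' (by simp)
  have ms := mem s' (by simp)
  by_cases h5 : p' = 0
  · have h6 : q' = a ∧ s' = a + 2 ∧ (r' = a ∨ r' = a + 2) := by
      split_ifs at hb' <;> omega
    obtain ⟨v, hv, hlt⟩ : ∃ v, Reach n ρ 0 a (a + 1) (a + 2) v ∧
        count 0 a (a + 1) (a + 2) v < count p' q' r' s' v := by
      obtain ⟨rfl, rfl, rfl | rfl⟩ := h6 <;> subst h5
      · exact Reach.exists_of_replace (v := r') (w := r' + 1) hg' hb (by omega)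
          (fun u => by unfold count; ring)
      · exact Reach.exists_of_replace (v := q' + 2) (w := q' + 1) hg' hb (by omega)
          (fun u => by unfold count; ring)
    exact absurd (H v hv) (not_le.2 hlt)
  · obtain ⟨rfl, rfl, rfl, rfl⟩ : p' = a ∧ q' = a ∧ r' = a + 2 ∧ s' = a + 2 := by omega
    -- Here the earlier monomial is `a² (a+2)²`, two exchanges away. The middle vertex `a + 1` moves
    -- up to `a + 2` for `a = 1`, where `n ≥ 2` keeps the result a generator of block (2c), and down
    -- to `a` otherwise.
    by_cases h6 : q' = 1
    · have := H (q' + 2) (reach_block_two (a₁ := q') (b₁ := q' + 2) (c₁ := q' + 2)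
        (w := q' + 1) hρ ha (by unfold IsGenerator; omega) ha
        (by split_ifs <;> omega) (fun u => by unfold count; ring))
      unfold count at this
      split_ifs at this <;> omega
    · have := H q' (reach_block_two (a₁ := q') (b₁ := q') (c₁ := q' + 2)
        (w := q' + 1) hρ ha (by unfold IsGenerator; omega) ha
        (by split_ifs <;> omega) (fun u => by unfold count; ring))
      unfold count at this
      split_ifs at this <;> omega

/-- If both gaps between `a, b, c` are at least two, every nonzero vertex is reachable, and `x`
occurs at most once in the earlier monomial. Each short gap creates exceptional vertices around it
and needs its own argument. -/
theorem exists_reach_block_two (hn : 2 ≤ n) (hρ : ρ ≤ 1) (hg : IsGenerator n 0 a b c)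
    (hg' : IsGenerator n p' q' r' s') (hb : Before n ρ p' q' r' s' 0 a b c) (ha : 1 ≤ a) :
    ∃ v, Reach n ρ 0 a b c v ∧ count 0 a b c v < count p' q' r' s' v := by
  have hg1 := hg
  have hg1' := hg'
  unfold IsGenerator at hg1 hg1'
  by_cases h1 : a + 2 ≤ b <;> by_cases h2 : b + 2 ≤ c
  · refine exists_reach_of_forall_reach hg hg' hb fun v hv => ?_
    rcases Nat.eq_zero_or_pos v with rfl | hpos
    · right
      have hb' := before_block_two_cases hρ ha hb
      unfold count; split_ifs <;> omega
    · exact Or.inl (reach_of_one_le_block_two hg ha hpos (by omega) (by omega))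
  · exact exists_reach_block_two_left hρ hg hg' hb ha h1 h2
  · exact exists_reach_block_two_right hρ hg hg' hb ha h1 h2
  · obtain ⟨rfl, rfl⟩ : b = a + 1 ∧ c = a + 2 := by omega
    exact exists_reach_block_two_consecutive hn hρ hg hg' hb ha

/-! ### Exchange property for generators divisible by `x²` -/

theorem reach_of_block_two_block_three (hg : IsGenerator n 0 0 a b) (hv : 1 ≤ v)
    (hvn : v ≤ n + 2) (h : a + 2 ≤ b ∨ v + 2 ≤ b ∨ a + 2 ≤ v) : Reach n ρ 0 0 a b v := by
  unfold IsGenerator at hg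
  have key : ∀ a₁ b₁ c₁, IsGenerator n 0 a₁ b₁ c₁ → 1 ≤ a₁ →
      (∀ u, count 0 a₁ b₁ c₁ u + (if 0 = u then 1 else 0) =
        count 0 0 a b u + (if v = u then 1 else 0)) → Reach n ρ 0 0 a b v := by
    intro a₁ b₁ c₁ h1 h2 h3
    refine ⟨0, a₁, b₁, c₁, 0, h1, Or.inl ?_, h3⟩
    unfold block
    split_ifs <;> omega
  by_cases h1 : v ≤ a
  · refine key v a b ?_ ?_ ?_
    · unfold IsGenerator; omega
    · omega
    · intro u; unfold count; ring
  · by_cases h2 : v ≤ b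
    · refine key a v b ?_ ?_ ?_
      · unfold IsGenerator; omega
      · omega
      · intro u; unfold count; ring
    · refine key a b v ?_ ?_ ?_
      · unfold IsGenerator; omega
      · omega
      · intro u; unfold count; ring

theorem before_block_three_iff {a₁ b₁ : ℕ} (hρ : ρ ≤ 1) :
    Before n ρ 0 0 a₁ b₁ 0 0 a b ↔
      (b₁ ≠ 2 ∧ b = 2) ∨ (b₁ = 2 ↔ b = 2) ∧ (a₁ < a ∨ a₁ = a ∧ b₁ < b) := by
  unfold Before LexLT block
  split_ifs <;> omega

/-- Replacing one `x` by `v` lands in an earlier block unless `a`, `b` and `v` lie pairwise within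
distance one. The remaining cases have `b = a` or `b = a + 1`. -/
theorem exists_reach_block_three (hn : 2 ≤ n) (hρ : ρ ≤ 1) (hg : IsGenerator n 0 0 a b)
    (hg' : IsGenerator n p' q' r' s') (hb : Before n ρ p' q' r' s' 0 0 a b) :
    ∃ v, Reach n ρ 0 0 a b v ∧ count 0 0 a b v < count p' q' r' s' v := by
  by_contra! H
  have hb' : 1 ≤ q' ∨ p' = 0 ∧ q' = 0 ∧
      ((s' ≠ 2 ∧ b = 2) ∨ (s' = 2 ↔ b = 2) ∧ (r' < a ∨ r' = a ∧ s' < b)) := by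
    rcases Nat.eq_zero_or_pos q' with rfl | h
    · obtain rfl : p' = 0 := by unfold IsGenerator at hg'; omega
      exact Or.inr ⟨rfl, rfl, (before_block_three_iff hρ).1 hb⟩
    · exact Or.inl h
  have swap : ∀ v w, (∀ u, count p' q' r' s' u + (if w = u then 1 else 0) =
      count 0 0 a b u + (if v = u then 1 else 0)) → count 0 0 a b v < count p' q' r' s' v →
      False := fun v w h hlt => absurd (H v ⟨p', q', r', s', w, hg', hb, h⟩) (not_le.2 hlt)
  have alt : ∀ a₁ b₁ w v, IsGenerator n 0 0 a₁ b₁ →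
      ((b₁ ≠ 2 ∧ b = 2) ∨ (b₁ = 2 ↔ b = 2) ∧ (a₁ < a ∨ a₁ = a ∧ b₁ < b)) →
      (∀ u, count 0 0 a₁ b₁ u + (if w = u then 1 else 0) =
        count 0 0 a b u + (if v = u then 1 else 0)) →
      count p' q' r' s' v ≤ count 0 0 a b v := fun a₁ b₁ w v h1 h3 h4 =>
    H v ⟨0, 0, a₁, b₁, w, h1, (before_block_three_iff hρ).2 h3, h4⟩
  have up : ∀ v, 1 ≤ v → v ≤ n + 2 → (a + 2 ≤ b ∨ v + 2 ≤ b ∨ a + 2 ≤ v) →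
      count p' q' r' s' v ≤ count 0 0 a b v := fun v h1 h2 h3 =>
    H v (reach_of_block_two_block_three hg h1 h2 h3)
  have hg1 := hg
  have hg1' := hg'
  unfold IsGenerator at hg hg'
  have mem : ∀ v, (v = p' ∨ v = q' ∨ v = r' ∨ v = s') → v = 0 ∨ v = a ∨ v = b ∨
      ¬ (a + 2 ≤ b ∨ v + 2 ≤ b ∨ a + 2 ≤ v) := by
    intro v hv
    by_contra! hc
    obtain ⟨h0, h1, h2, h4⟩ := hc
    have := mem_of_count_le (up v (by omega) (by omega) (by omega)) hv
    omega
  have mp := mem p' (by simp)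
  have mq := mem q' (by simp)
  have mr := mem r' (by simp)
  have ms := mem s' (by simp)
  by_cases h1 : a + 2 ≤ b
  · obtain ⟨v, hv, hlt⟩ : ∃ v, Reach n ρ 0 0 a b v ∧ count 0 0 a b v < count p' q' r' s' v :=
      exists_reach_of_forall_reach hg1 hg1' hb fun v hv => by
        rcases Nat.eq_zero_or_pos v with rfl | hpos
        · right; unfold count; split_ifs <;> omega
        · exact Or.inl (reach_of_block_two_block_three hg1 hpos (by omega) (Or.inl h1))
    exact absurd (H v hv) (not_le.2 hlt)
  · by_cases h3 : b = a
    · subst h3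
      -- For `x² y₁²`, listed last, `x² y₁ y₂` is earlier and makes `y₂` reachable; any other square
      -- is preceded by the product with the next lower `y`.
      by_cases h4 : b = 2
      · have hm := fun h => mem_of_count_le (alt b (b + 1) b (b + 1)
          (by unfold IsGenerator; omega) (by omega) (fun u => by unfold count; ring)) h
        omega
      · have hm := fun h => mem_of_count_le (alt (b - 1) b b (b - 1)
          (by unfold IsGenerator; omega) (by omega) (fun u => by unfold count; ring)) h
        obtain ⟨rfl, rfl, rfl, rfl⟩ : p' = 0 ∧ q' = 0 ∧ r' = b ∧ s' = b + 1 := by omega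
        exact swap (r' + 1) r' (fun u => by unfold count; ring)
          (by unfold count; split_ifs <;> omega)
    · obtain ⟨rfl, rfl, ⟨rfl, rfl⟩ | ⟨rfl, rfl⟩⟩ :
          p' = 0 ∧ q' = 0 ∧ (r' = a ∧ s' = a ∨ r' = b ∧ s' = b) := by omega
      · exact swap s' b (fun u => by unfold count; ring) (by unfold count; split_ifs <;> omega)
      · exact swap s' a (fun u => by unfold count; ring) (by unfold count; split_ifs <;> omega)

theorem exists_reach (hn : 2 ≤ n) (hρ : ρ ≤ 1) (hg : IsGenerator n p q r s)
    (hg' : IsGenerator n p' q' r' s') (hb : Before n ρ p' q' r' s' p q r s) :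
    ∃ v, Reach n ρ p q r s v ∧ count p q r s v < count p' q' r' s' v := by
  rcases Nat.eq_zero_or_pos p with rfl | hp
  · rcases Nat.eq_zero_or_pos q with rfl | hq
    · exact exists_reach_block_three hn hρ hg hg' hb
    · exact exists_reach_block_two hn hρ hg hg' hb hq
  · exact exists_reach_of_one_le hg hg' hb hp

end Quadruple

noncomputable section

/-! ## Monomial ideals generated in one degree -/

section MonomialIdeal

variable {k : Type*} [Field k] {V : Type*}

theorem Finsupp.eq_of_le_of_degree_eq {s m : V →₀ ℕ} (h : s ≤ m) (hd : s.degree = m.degree) :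
    s = m := by
  have h1 : s.degree + (m - s).degree = m.degree := by
    rw [← map_add, add_tsub_cancel_of_le h]
  have h2 : m - s = 0 := (Finsupp.degree_eq_zero_iff _).1 (by omega)
  rw [← add_tsub_cancel_of_le h, h2, add_zero]

theorem monomial_mem_monomialIdeal {S : Set (V →₀ ℕ)} {m : V →₀ ℕ} :
    monomial m (1 : k) ∈ monomialIdeal k S ↔ ∃ s ∈ S, s ≤ m := by
  classical
  rw [monomialIdeal, mem_ideal_span_monomial_image, support_monomial, if_neg one_ne_zero]
  simp

theorem monomial_mem_monomialIdeal_of_degree {S : Set (V →₀ ℕ)} {d : ℕ}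
    (hS : ∀ s ∈ S, s.degree = d) {m : V →₀ ℕ} (hm : m.degree = d) :
    monomial m (1 : k) ∈ monomialIdeal k S ↔ m ∈ S := by
  rw [monomial_mem_monomialIdeal]
  constructor
  · rintro ⟨s, hs, hle⟩
    rwa [← Finsupp.eq_of_le_of_degree_eq hle ((hS s hs).trans hm.symm)]
  · exact fun h => ⟨m, h, le_rfl⟩

theorem isMinimalMonomial_monomialIdeal {S : Set (V →₀ ℕ)} {d : ℕ}
    (hS : ∀ s ∈ S, s.degree = d) {m : V →₀ ℕ} :
    IsMinimalMonomial (monomialIdeal k S) m ↔ m ∈ S := by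
  constructor
  · rintro ⟨h1, h2⟩
    obtain ⟨s, hs, hle⟩ := monomial_mem_monomialIdeal.1 h1
    rwa [← h2 s hle (monomial_mem_monomialIdeal.2 ⟨s, hs, le_rfl⟩)]
  · intro hm
    refine ⟨monomial_mem_monomialIdeal.2 ⟨m, hm, le_rfl⟩, fun m' hle hm' => ?_⟩
    obtain ⟨s, hs, hsm⟩ := monomial_mem_monomialIdeal.1 hm'
    have := Finsupp.eq_of_le_of_degree_eq (hsm.trans hle) ((hS s hs).trans (hS m hm).symm)
    exact le_antisymm hle (this ▸ hsm)

/-- A monomial `u` with `u m` divisible by `m'` must be divisible by every variable whose exponent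
in `m'` exceeds that in `m`; the hypothesis supplies such a variable that lies in the colon ideal.
-/
theorem colon_monomialIdeal {A : Set (V →₀ ℕ)} {m : V →₀ ℕ}
    (h : ∀ m' ∈ A, ∃ v, (∃ s ∈ A, s ≤ m + Finsupp.single v 1) ∧ m v < m' v) :
    (monomialIdeal k A).colon {monomial m (1 : k)} =
      Ideal.span ((fun v => (X v : MvPolynomial V k)) ''
        {v | ∃ s ∈ A, s ≤ m + Finsupp.single v 1}) := by
  apply le_antisymm
  · intro f hf
    rw [Submodule.mem_colon_singleton, smul_eq_mul, monomialIdeal,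
      mem_ideal_span_monomial_image] at hf
    rw [mem_ideal_span_X_image]
    intro u hu
    obtain ⟨m', hm', hle⟩ := hf (u + m) (by
      rw [mem_support_iff, coeff_mul_monomial, mul_one]
      exact mem_support_iff.1 hu)
    obtain ⟨v, hv, hlt⟩ := h m' hm'
    refine ⟨v, hv, ?_⟩
    have := hle v
    rw [Finsupp.add_apply] at this
    omega
  · rw [Ideal.span_le]
    rintro _ ⟨v, hv, rfl⟩
    rw [SetLike.mem_coe, Submodule.mem_colon_singleton, smul_eq_mul]
    have : (X v : MvPolynomial V k) * monomial m 1 = monomial (m + Finsupp.single v 1) 1 := by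
      rw [X, monomial_mul, add_comm, one_mul]
    dsimp only
    rw [this]
    exact monomial_mem_monomialIdeal.2 hv

end MonomialIdeal

/-! ### Lists sorted by a strict order -/

theorem List.Pairwise.mem_take_iff {α : Type*} {R : α → α → Prop} {l : List α}
    (hl : l.Pairwise R) (hR : ∀ a b, R a b → ¬ R b a) {i : ℕ} (hi : i < l.length) {a : α} :
    a ∈ l.take i ↔ a ∈ l ∧ R a l[i] := by
  rw [List.pairwise_iff_getElem] at hl
  constructor
  · intro ha
    obtain ⟨j, hj, rfl⟩ := List.getElem_of_mem ha
    rw [List.length_take] at hj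
    rw [List.getElem_take]
    exact ⟨List.getElem_mem _, hl j i _ hi (by omega)⟩
  · rintro ⟨ha, hr⟩
    obtain ⟨j, hj, rfl⟩ := List.getElem_of_mem ha
    have hji : j < i := by
      rcases lt_trichotomy j i with h | h | h
      · exact h
      · subst h; exact absurd hr (hR _ _ hr)
      · exact absurd (hl i j hi hj h) (hR _ _ hr)
    rw [List.mem_take_iff_getElem]
    exact ⟨j, by omega, rfl⟩

theorem Finset.exists_list_pairwise {α : Type*} (r : α → α → Prop) [IsStrictTotalOrder α r]
    (S : Finset α) : ∃ l : List α, (∀ a, a ∈ l ↔ a ∈ S) ∧ l.Pairwise r := by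
  classical
  let := linearOrderOfSTO r
  exact ⟨S.sort, fun a => S.mem_sort _, S.sortedLT_sort.pairwise⟩

/-! ## The exponent vectors of quadruples -/

namespace Quadruple

/-- The generators listed in a given block, as a finite set. -/
def blockFinset (n i : ℕ) : Finset (ℕ × ℕ × ℕ × ℕ) :=
  open Classical in
  ((Finset.range (n + 3)) ×ˢ (Finset.range (n + 3)) ×ˢ (Finset.range (n + 3)) ×ˢ
    (Finset.range (n + 3))).filter fun t =>
      IsGenerator n t.1 t.2.1 t.2.2.1 t.2.2.2 ∧ block n t.1 t.2.1 t.2.2.1 t.2.2.2 = i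

theorem mem_blockFinset {n i : ℕ} {t : ℕ × ℕ × ℕ × ℕ} :
    t ∈ blockFinset n i ↔
      IsGenerator n t.1 t.2.1 t.2.2.1 t.2.2.2 ∧ block n t.1 t.2.1 t.2.2.1 t.2.2.2 = i := by
  obtain ⟨p, q, r, s⟩ := t
  simp only [blockFinset, Finset.mem_filter, Finset.mem_product, Finset.mem_range,
    and_iff_right_iff_imp]
  unfold IsGenerator
  omega

/-- `Before`, as a relation between quadruples. -/
def BeforeQ (n ρ : ℕ) (t' t : ℕ × ℕ × ℕ × ℕ) : Prop :=
  Before n ρ t'.1 t'.2.1 t'.2.2.1 t'.2.2.2 t.1 t.2.1 t.2.2.1 t.2.2.2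

instance (n ρ : ℕ) : IsStrictTotalOrder (ℕ × ℕ × ℕ × ℕ) (BeforeQ n ρ) where
  trichotomous := by
    rintro ⟨p, q, r, s⟩ ⟨p', q', r', s'⟩ h h'
    simp only [BeforeQ, Before, LexLT, Prod.mk.injEq] at *
    omega
  irrefl := by
    rintro ⟨p, q, r, s⟩ h
    simp only [BeforeQ, Before, LexLT] at h
    omega
  trans := by
    rintro ⟨p, q, r, s⟩ ⟨p', q', r', s'⟩ ⟨p'', q'', r'', s''⟩ h h'
    simp only [BeforeQ, Before] at *
    generalize block n p q r s = b at *
    generalize block n p' q' r' s' = b' at *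
    generalize block n p'' q'' r'' s'' = b'' at *
    rcases h with h | ⟨rfl, ⟨h1, h⟩ | ⟨h1, h⟩⟩ <;> rcases h' with h' | ⟨rfl, ⟨h1', h'⟩ | ⟨h1', h'⟩⟩ <;>
      first
      | omega
      | exact absurd h1 h1'
      | exact absurd h1' h1
      | (refine Or.inr ⟨rfl, Or.inl ⟨h1, ?_⟩⟩; unfold LexLT at *; omega)
      | (refine Or.inr ⟨rfl, Or.inr ⟨h1, ?_⟩⟩; unfold LexLT at *; omega)

/-- The exponent vector of the monomial given by a quadruple. -/
def expVec (n : ℕ) (t : ℕ × ℕ × ℕ × ℕ) : Fin (n + 3) →₀ ℕ :=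
  Finsupp.equivFunOnFinite.symm fun v => count t.1 t.2.1 t.2.2.1 t.2.2.2 v

theorem expVec_apply (n p q r s : ℕ) (v : Fin (n + 3)) :
    expVec n (p, q, r, s) v = count p q r s v := rfl

theorem exps_eq_expVec {n : ℕ} (a b c d : Fin (n + 3)) :
    Anticycle.exps a b c d = expVec n (a, b, c, d) := by
  ext v
  simp [Anticycle.exps, expVec_apply, count, Finsupp.single_apply, Fin.ext_iff]

theorem degree_exps {n : ℕ} (a b c d : Fin (n + 3)) :
    (Anticycle.exps a b c d).degree = 4 := by
  simp [Anticycle.exps, Finsupp.degree_single]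

theorem expVec_eq_exps {n p q r s : ℕ} (hp : p < n + 3) (hq : q < n + 3) (hr : r < n + 3)
    (hs : s < n + 3) : expVec n (p, q, r, s) = Anticycle.exps ⟨p, hp⟩ ⟨q, hq⟩ ⟨r, hr⟩ ⟨s, hs⟩ := by
  rw [exps_eq_expVec]

theorem degree_expVec {n p q r s : ℕ} (hg : IsGenerator n p q r s) :
    (expVec n (p, q, r, s)).degree = 4 := by
  unfold IsGenerator at hg
  rw [expVec_eq_exps (by omega) (by omega) (by omega) (by omega), degree_exps]

theorem expVec_congr {n p q r s p' q' r' s' : ℕ}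
    (h : ∀ u, count p q r s u = count p' q' r' s' u) :
    expVec n (p, q, r, s) = expVec n (p', q', r', s') := by
  ext v
  exact h v

theorem expVec_injective {n p q r s p' q' r' s' : ℕ} (h1 : p ≤ q) (h2 : q ≤ r) (h3 : r ≤ s)
    (h1' : p' ≤ q') (h2' : q' ≤ r') (h3' : r' ≤ s') (h4' : s' < n + 3)
    (h : expVec n (p', q', r', s') = expVec n (p, q, r, s)) :
    p' = p ∧ q' = q ∧ r' = r ∧ s' = s := by
  refine eq_of_count_le h1 h2 h3 h1' h2' h3' fun u => ?_
  by_cases hu : u < n + 3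
  · exact (DFunLike.congr_fun h ⟨u, hu⟩).le
  · have : count p' q' r' s' u = 0 := by unfold count; split_ifs <;> omega
    omega

/-- At the first differing entry of two sorted quadruples, the smaller entry is the first variable
whose exponents differ, and its own quadruple has the larger exponent there. -/
theorem lex_lt_expVec {n p q r s p' q' r' s' : ℕ} (h1 : p ≤ q) (h2 : q ≤ r) (h3 : r ≤ s)
    (h4 : s < n + 3) (h1' : p' ≤ q') (h2' : q' ≤ r') (h3' : r' ≤ s') (h4' : s' < n + 3)
    (h : LexLT p' q' r' s' p q r s) :
    Finsupp.Lex (· < ·) (· > ·) (expVec n (p', q', r', s')) (expVec n (p, q, r, s)) := by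
  have key : ∀ w < n + 3, (∀ u < w, count p' q' r' s' u = count p q r s u) →
      count p q r s w < count p' q' r' s' w →
      Finsupp.Lex (· < ·) (· > ·) (expVec n (p', q', r', s')) (expVec n (p, q, r, s)) := by
    intro w hw hlt hgt
    exact Finsupp.lex_def.2 ⟨⟨w, hw⟩, fun d hd => hlt d hd, hgt⟩
  unfold LexLT at h
  rcases h with h | ⟨rfl, h | ⟨rfl, h | ⟨rfl, h⟩⟩⟩
  · refine key p' (by omega) (fun u hu => ?_) ?_ <;> unfold count <;> split_ifs <;> omega
  · refine key q' (by omega) (fun u hu => ?_) ?_ <;> unfold count <;> split_ifs <;> omega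
  · refine key r' (by omega) (fun u hu => ?_) ?_ <;> unfold count <;> split_ifs <;> omega
  · refine key s' (by omega) (fun u hu => ?_) ?_ <;> unfold count <;> split_ifs <;> omega

theorem lex_gt_expVec {n p q r s p' q' r' s' : ℕ} (h1 : p ≤ q) (h2 : q ≤ r) (h3 : r ≤ s)
    (h4 : s < n + 3) (h1' : p' ≤ q') (h2' : q' ≤ r') (h3' : r' ≤ s') (h4' : s' < n + 3)
    (h : LexLT s r q p s' r' q' p') :
    Finsupp.Lex (· > ·) (· > ·) (expVec n (p', q', r', s')) (expVec n (p, q, r, s)) := by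
  have key : ∀ w < n + 3, (∀ u > w, count p' q' r' s' u = count p q r s u) →
      count p q r s w < count p' q' r' s' w →
      Finsupp.Lex (· > ·) (· > ·) (expVec n (p', q', r', s')) (expVec n (p, q, r, s)) := by
    intro w hw hlt hgt
    exact Finsupp.lex_def.2 ⟨⟨w, hw⟩, fun d hd => hlt d hd, hgt⟩
  unfold LexLT at h
  rcases h with h | ⟨rfl, h | ⟨rfl, h | ⟨rfl, h⟩⟩⟩
  · refine key s' (by omega) (fun u hu => ?_) ?_ <;> unfold count <;> split_ifs <;> omega
  · refine key r' (by omega) (fun u hu => ?_) ?_ <;> unfold count <;> split_ifs <;> omega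
  · refine key q' (by omega) (fun u hu => ?_) ?_ <;> unfold count <;> split_ifs <;> omega
  · refine key p' (by omega) (fun u hu => ?_) ?_ <;> unfold count <;> split_ifs <;> omega

/-- The product of two edges of the anticycle is the monomial of a generating quadruple. -/
theorem exists_isGenerator {n a b c d : ℕ} (hb : b ≤ n + 2) (hd : d ≤ n + 2) (hab : a + 2 ≤ b)
    (hcd : c + 2 ≤ d) (hab' : ¬ (a = 0 ∧ b = n + 2)) (hcd' : ¬ (c = 0 ∧ d = n + 2)) :
    ∃ p q r s, IsGenerator n p q r s ∧ (∀ u, count a b c d u = count p q r s u) ∧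
      (1 ≤ a → 1 ≤ c → 1 ≤ p) := by
  rcases le_total a c with h | h
  · rcases le_total b c with h1 | h1
    · exact ⟨a, b, c, d, by unfold IsGenerator; omega, fun u => rfl, by omega⟩
    · rcases le_total b d with h2 | h2
      · exact ⟨a, c, b, d, by unfold IsGenerator; omega, fun u => by unfold count; ring, by omega⟩
      · exact ⟨a, c, d, b, by unfold IsGenerator; omega, fun u => by unfold count; ring, by omega⟩
  · rcases le_total d a with h1 | h1
    · exact ⟨c, d, a, b, by unfold IsGenerator; omega, fun u => by unfold count; ring, by omega⟩
    · rcases le_total b d with h2 | h2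
      · exact ⟨c, a, b, d, by unfold IsGenerator; omega, fun u => by unfold count; ring, by omega⟩
      · exact ⟨c, a, d, b, by unfold IsGenerator; omega, fun u => by unfold count; ring, by omega⟩

end Quadruple

/-! ## The edges of the anticycle -/

namespace Anticycle

theorem adj_iff {n : ℕ} (a b : Fin (n + 3)) :
    (anticycle (n + 3)).Adj a b ↔
      ((a : ℕ) + 2 ≤ b ∧ ¬ ((a : ℕ) = 0 ∧ (b : ℕ) = n + 2)) ∨
        ((b : ℕ) + 2 ≤ a ∧ ¬ ((b : ℕ) = 0 ∧ (a : ℕ) = n + 2)) := by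
  rw [anticycle, SimpleGraph.compl_adj, SimpleGraph.cycleGraph_adj', ne_eq, Fin.ext_iff]
  rcases lt_trichotomy a b with h | h | h
  · rw [Fin.sub_val_of_le h.le, Fin.coe_sub_iff_lt.2 h]
    rw [Fin.lt_def] at h
    omega
  · subst h; simp
  · rw [Fin.sub_val_of_le h.le, Fin.coe_sub_iff_lt.2 h]
    rw [Fin.lt_def] at h
    omega

theorem H_adj_iff {n : ℕ} (a b : Fin (n + 3)) :
    (H n).Adj a b ↔ 1 ≤ (a : ℕ) ∧ 1 ≤ (b : ℕ) ∧ ((a : ℕ) + 2 ≤ b ∨ (b : ℕ) + 2 ≤ a) := by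
  rw [H, SimpleGraph.deleteIncidenceSet_adj, adj_iff, x, ne_eq, ne_eq, Fin.ext_iff, Fin.ext_iff]
  simp only
  omega

theorem K_adj_iff {n : ℕ} (a b : Fin (n + 3)) :
    (anticycle (n + 3) \ H n).Adj a b ↔
      (a : ℕ) = 0 ∧ 2 ≤ (b : ℕ) ∧ (b : ℕ) ≤ n + 1 ∨
        (b : ℕ) = 0 ∧ 2 ≤ (a : ℕ) ∧ (a : ℕ) ≤ n + 1 := by
  rw [SimpleGraph.sdiff_adj, H_adj_iff, adj_iff]
  omega

theorem K_eq (k : Type*) [Field k] (n : ℕ) :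
    K k n = Ideal.span (Set.range fun i : Fin n =>
      (X (x n) * X (y i) : MvPolynomial (Fin (n + 3)) k)) := by
  rw [K, edgeIdeal]
  congr 1
  ext f
  simp only [Set.mem_range, K_adj_iff]
  constructor
  · rintro ⟨a, b, h, rfl⟩
    rcases h with ⟨h1, h2, h3⟩ | ⟨h1, h2, h3⟩
    · refine ⟨⟨b - 2, by omega⟩, ?_⟩
      congr 2
      · exact Fin.ext h1.symm
      · simp only [y, Fin.ext_iff]; omega
    · refine ⟨⟨a - 2, by omega⟩, ?_⟩
      rw [mul_comm]
      congr 2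
      · simp only [y, Fin.ext_iff]; omega
      · exact Fin.ext h1.symm
  · rintro ⟨i, rfl⟩
    exact ⟨x n, y i, Or.inl ⟨rfl, Nat.le_add_left 2 i, by change (i : ℕ) + 2 ≤ n + 1; omega⟩, rfl⟩

theorem edgeIdeal_mul (k : Type*) [Field k] {n : ℕ} (G₁ G₂ : SimpleGraph (Fin (n + 3))) :
    edgeIdeal k G₁ * edgeIdeal k G₂ = monomialIdeal k
      {m | ∃ a b c d, G₁.Adj a b ∧ G₂.Adj c d ∧ m = exps a b c d} := by
  have hmon : ∀ a b c d : Fin (n + 3),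
      monomial (exps a b c d) (1 : k) = X a * X b * (X c * X d) := by
    intro a b c d
    simp only [X, monomial_mul, exps, mul_one, add_assoc]
  rw [edgeIdeal, edgeIdeal, Ideal.span_mul_span', monomialIdeal]
  congr 1
  ext f
  rw [Set.mem_mul]
  constructor
  · rintro ⟨_, ⟨a, b, hab, rfl⟩, _, ⟨c, d, hcd, rfl⟩, rfl⟩
    exact ⟨_, ⟨a, b, c, d, hab, hcd, rfl⟩, hmon a b c d⟩
  · rintro ⟨_, ⟨a, b, c, d, hab, hcd, rfl⟩, rfl⟩
    exact ⟨_, ⟨a, b, hab, rfl⟩, _, ⟨c, d, hcd, rfl⟩, (hmon a b c d).symm⟩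

open Quadruple

theorem exps_swap_left {n : ℕ} (a b c d : Fin (n + 3)) : exps a b c d = exps b a c d := by
  simp only [exps]; abel

theorem exps_swap_right {n : ℕ} (a b c d : Fin (n + 3)) : exps a b c d = exps a b d c := by
  simp only [exps]; abel

theorem exists_isGenerator_of_adj {n : ℕ} {a b c d : Fin (n + 3)}
    (hab : (anticycle (n + 3)).Adj a b) (hcd : (anticycle (n + 3)).Adj c d) :
    ∃ p q r s, IsGenerator n p q r s ∧ exps a b c d = expVec n (p, q, r, s) ∧
      (1 ≤ (a : ℕ) → 1 ≤ (b : ℕ) → 1 ≤ (c : ℕ) → 1 ≤ (d : ℕ) → 1 ≤ p) := by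
  rw [adj_iff] at hab hcd
  have key : ∀ a b c d : Fin (n + 3), (a : ℕ) + 2 ≤ b → ¬ ((a : ℕ) = 0 ∧ (b : ℕ) = n + 2) →
      (c : ℕ) + 2 ≤ d → ¬ ((c : ℕ) = 0 ∧ (d : ℕ) = n + 2) →
      ∃ p q r s, IsGenerator n p q r s ∧ exps a b c d = expVec n (p, q, r, s) ∧
        (1 ≤ (a : ℕ) → 1 ≤ (c : ℕ) → 1 ≤ p) := by
    intro a b c d h1 h2 h3 h4
    obtain ⟨p, q, r, s, hg, hc, hp⟩ :=
      exists_isGenerator (n := n) (by omega) (by omega) h1 h3 h2 h4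
    exact ⟨p, q, r, s, hg, by rw [exps_eq_expVec]; exact expVec_congr hc, hp⟩
  rcases hab with ⟨h1, h2⟩ | ⟨h1, h2⟩ <;> rcases hcd with ⟨h3, h4⟩ | ⟨h3, h4⟩
  · obtain ⟨p, q, r, s, hg, he, hp⟩ := key a b c d h1 h2 h3 h4
    exact ⟨p, q, r, s, hg, he, fun ha _ hc _ => hp ha hc⟩
  · obtain ⟨p, q, r, s, hg, he, hp⟩ := key a b d c h1 h2 h3 h4
    exact ⟨p, q, r, s, hg, (exps_swap_right _ _ _ _).trans he, fun ha _ _ hd => hp ha hd⟩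
  · obtain ⟨p, q, r, s, hg, he, hp⟩ := key b a c d h1 h2 h3 h4
    exact ⟨p, q, r, s, hg, (exps_swap_left _ _ _ _).trans he, fun _ hb hc _ => hp hb hc⟩
  · obtain ⟨p, q, r, s, hg, he, hp⟩ := key b a d c h1 h2 h3 h4
    exact ⟨p, q, r, s, hg, (exps_swap_left _ _ _ _).trans ((exps_swap_right _ _ _ _).trans he),
      fun _ hb _ hd => hp hb hd⟩

theorem edgeIdeal_sq (k : Type*) [Field k] (n : ℕ) :
    edgeIdeal k (anticycle (n + 3)) ^ 2 = monomialIdeal k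
      {m | ∃ p q r s, IsGenerator n p q r s ∧ m = expVec n (p, q, r, s)} := by
  rw [sq, edgeIdeal_mul]
  congr 1
  ext m
  constructor
  · rintro ⟨a, b, c, d, hab, hcd, rfl⟩
    obtain ⟨p, q, r, s, hg, he, -⟩ := exists_isGenerator_of_adj hab hcd
    exact ⟨p, q, r, s, hg, he⟩
  · rintro ⟨p, q, r, s, hg, rfl⟩
    unfold IsGenerator at hg
    -- The two edges of a sorted quadruple are `{p, r}` and `{q, s}`.
    refine ⟨⟨p, by omega⟩, ⟨r, by omega⟩, ⟨q, by omega⟩, ⟨s, by omega⟩, ?_, ?_, ?_⟩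
    · rw [adj_iff]; simp only; omega
    · rw [adj_iff]; simp only; omega
    · rw [exps_eq_expVec]
      exact expVec_congr fun u => by unfold count; ring

theorem J_sq (k : Type*) [Field k] (n : ℕ) :
    J k n ^ 2 = monomialIdeal k
      {m | ∃ p q r s, IsGenerator n p q r s ∧ 1 ≤ p ∧ m = expVec n (p, q, r, s)} := by
  rw [sq, J, edgeIdeal_mul]
  congr 1
  ext m
  constructor
  · rintro ⟨a, b, c, d, hab, hcd, rfl⟩
    have ha := (H_adj_iff a b).1 hab
    have hc := (H_adj_iff c d).1 hcd
    obtain ⟨p, q, r, s, hg, he, hp⟩ := exists_isGenerator_of_adj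
      (SimpleGraph.deleteIncidenceSet_adj.1 hab).1 (SimpleGraph.deleteIncidenceSet_adj.1 hcd).1
    exact ⟨p, q, r, s, hg, hp ha.1 ha.2.1 hc.1 hc.2.1, he⟩
  · rintro ⟨p, q, r, s, hg, hp, rfl⟩
    unfold IsGenerator at hg
    refine ⟨⟨p, by omega⟩, ⟨r, by omega⟩, ⟨q, by omega⟩, ⟨s, by omega⟩, ?_, ?_, ?_⟩
    · rw [H_adj_iff]; simp only; omega
    · rw [H_adj_iff]; simp only; omega
    · rw [exps_eq_expVec]
      exact expVec_congr fun u => by unfold count; ring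

end Anticycle

end

noncomputable section

/-! ### The blocks as sets of quadruples, and the final list -/

namespace Anticycle

open Quadruple

/-- The exponent vectors of the generators in a given block. -/
def blockSet (n i : ℕ) : Set (Fin (n + 3) →₀ ℕ) :=
  {m | ∃ p q r s, IsGenerator n p q r s ∧ block n p q r s = i ∧ m = expVec n (p, q, r, s)}

theorem block_eq_one {n p q r s : ℕ} : block n p q r s = 1 ↔ 1 ≤ p := by
  unfold block; split_ifs <;> omega

theorem mem_blockSet_of_eq {n i p q r s : ℕ} {m : Fin (n + 3) →₀ ℕ}
    (hg : IsGenerator n p q r s) (hb : block n p q r s = i) (hm : m = expVec n (p, q, r, s)) :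
    m ∈ blockSet n i := ⟨p, q, r, s, hg, hb, hm⟩

theorem exps_eq_of_val {n p q r s : ℕ} {a b c d : Fin (n + 3)} (ha : (a : ℕ) = p)
    (hb : (b : ℕ) = q) (hc : (c : ℕ) = r) (hd : (d : ℕ) = s) :
    exps a b c d = expVec n (p, q, r, s) := by
  subst ha hb hc hd
  exact exps_eq_expVec a b c d

theorem exps_x_y_z₁_z₂ {n : ℕ} (i : Fin n) :
    exps (x n) (y i) (z₁ n) (z₂ n) = expVec n (0, 1, i + 2, n + 2) := by
  rw [exps_eq_of_val (p := 0) (q := i + 2) (r := 1) (s := n + 2) rfl rfl rfl rfl]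
  exact expVec_congr fun u => by unfold count; ring

theorem exps_x_y_y_z₂ {n : ℕ} (i j : Fin n) :
    exps (x n) (y i) (y j) (z₂ n) = expVec n (0, i + 2, j + 2, n + 2) :=
  exps_eq_of_val rfl rfl rfl rfl

theorem exps_x_y_y_z₁ {n : ℕ} (i j : Fin n) :
    exps (x n) (y i) (y j) (z₁ n) = expVec n (0, 1, i + 2, j + 2) := by
  rw [exps_eq_of_val (p := 0) (q := i + 2) (r := j + 2) (s := 1) rfl rfl rfl rfl]
  exact expVec_congr fun u => by unfold count; ring

theorem exps_x_y_y_y {n : ℕ} (i j l : Fin n) :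
    exps (x n) (y i) (y j) (y l) = expVec n (0, i + 2, j + 2, l + 2) :=
  exps_eq_of_val rfl rfl rfl rfl

theorem exps_x_x_y_y {n : ℕ} (i j : Fin n) :
    exps (x n) (x n) (y i) (y j) = expVec n (0, 0, i + 2, j + 2) :=
  exps_eq_of_val rfl rfl rfl rfl

theorem block1_eq (k : Type*) [Field k] (n : ℕ) : block1 k n = blockSet n 1 := by
  ext m
  change IsMinimalMonomial _ m ↔ _
  rw [J_sq, isMinimalMonomial_monomialIdeal (d := 4)]
  · constructor
    · rintro ⟨p, q, r, s, hg, hp, rfl⟩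
      exact ⟨p, q, r, s, hg, block_eq_one.2 hp, rfl⟩
    · rintro ⟨p, q, r, s, hg, hp, rfl⟩
      exact ⟨p, q, r, s, hg, block_eq_one.1 hp, rfl⟩
  · rintro _ ⟨p, q, r, s, hg, -, rfl⟩
    exact degree_expVec hg

theorem block2a_eq {n : ℕ} (hn : 2 ≤ n) : block2a n = blockSet n 2 := by
  ext m
  constructor
  · rintro ⟨i, rfl⟩
    refine mem_blockSet_of_eq ?_ ?_ (exps_x_y_z₁_z₂ i)
    · unfold IsGenerator; omega
    · unfold block; split_ifs <;> omega
  · rintro ⟨p, q, r, s, hg, hb, rfl⟩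
    unfold IsGenerator at hg
    obtain ⟨rfl, rfl, rfl⟩ : p = 0 ∧ q = 1 ∧ s = n + 2 := by
      unfold block at hb; split_ifs at hb <;> omega
    obtain ⟨r, rfl⟩ : ∃ r', r = r' + 2 := Nat.exists_eq_add_of_le' (by omega)
    exact ⟨⟨r, by omega⟩, (exps_x_y_z₁_z₂ ⟨r, by omega⟩).symm⟩

theorem block2b_eq {n : ℕ} : block2b n = blockSet n 3 := by
  ext m
  constructor
  · rintro ⟨i, j, hij, hne, rfl⟩
    rw [Fin.le_def] at hij
    refine mem_blockSet_of_eq ?_ ?_ (exps_x_y_y_z₂ i j)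
    · unfold IsGenerator; omega
    · unfold block; split_ifs <;> omega
  · rintro ⟨p, q, r, s, hg, hb, rfl⟩
    unfold IsGenerator at hg
    obtain ⟨rfl, hq, rfl⟩ : p = 0 ∧ 2 ≤ q ∧ s = n + 2 := by
      unfold block at hb; split_ifs at hb <;> omega
    obtain ⟨q, rfl⟩ : ∃ q', q = q' + 2 := Nat.exists_eq_add_of_le' hq
    obtain ⟨r, rfl⟩ : ∃ r', r = r' + 2 := Nat.exists_eq_add_of_le' (by omega)
    refine ⟨⟨q, by omega⟩, ⟨r, by omega⟩, ?_, ?_,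
      (exps_x_y_y_z₂ ⟨q, by omega⟩ ⟨r, by omega⟩).symm⟩
    · rw [Fin.le_def]; simp only; omega
    · simp only; omega

theorem block2c_eq {n : ℕ} : block2c n = blockSet n 4 := by
  ext m
  constructor
  · rintro ⟨i, j, hij, hne, rfl⟩
    rw [Fin.le_def] at hij
    refine mem_blockSet_of_eq ?_ ?_ (exps_x_y_y_z₁ i j)
    · unfold IsGenerator; omega
    · unfold block; split_ifs <;> omega
  · rintro ⟨p, q, r, s, hg, hb, rfl⟩
    unfold IsGenerator at hg
    obtain ⟨rfl, rfl, hs⟩ : p = 0 ∧ q = 1 ∧ s ≤ n + 1 := by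
      unfold block at hb; split_ifs at hb <;> omega
    obtain ⟨r, rfl⟩ : ∃ r', r = r' + 2 := Nat.exists_eq_add_of_le' (by omega)
    obtain ⟨s, rfl⟩ : ∃ s', s = s' + 2 := Nat.exists_eq_add_of_le' (by omega)
    refine ⟨⟨r, by omega⟩, ⟨s, by omega⟩, ?_, ?_,
      (exps_x_y_y_z₁ ⟨r, by omega⟩ ⟨s, by omega⟩).symm⟩
    · rw [Fin.le_def]; simp only; omega
    · simp only; omega

/-- As `J K` is generated in degree 4, a monomial of degree 4 in it is the product of an edge of `H`
and an edge at `x`; sorting this product recovers the quadruple. -/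
theorem block2d_eq (k : Type*) [Field k] {n : ℕ} : block2d k n = blockSet n 5 := by
  have hdeg : ∀ m ∈ {m | ∃ a b c d : Fin (n + 3), (H n).Adj a b ∧
      (anticycle (n + 3) \ H n).Adj c d ∧ m = exps a b c d}, m.degree = 4 := by
    rintro _ ⟨a, b, c, d, -, -, rfl⟩
    exact degree_exps a b c d
  ext m
  constructor
  · rintro ⟨hm, i, j, l, hij, hjl, rfl⟩
    rw [J, K, edgeIdeal_mul,
      monomial_mem_monomialIdeal_of_degree hdeg (degree_exps _ _ _ _)] at hm
    obtain ⟨a, b, c, d, hab, hcd, he⟩ := hm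
    obtain ⟨p, q, r, s, hg, he', -⟩ := exists_isGenerator_of_adj
      (SimpleGraph.deleteIncidenceSet_adj.1 hab).1 ((SimpleGraph.sdiff_adj _ _ _ _).1 hcd).1
    rw [he', exps_x_y_y_y] at he
    rw [exps_x_y_y_y]
    rw [Fin.le_def] at hij hjl
    have hg1 := hg
    unfold IsGenerator at hg1
    obtain ⟨rfl, rfl, rfl, rfl⟩ := expVec_injective (n := n) (by omega) (by omega) (by omega)
      (by omega) (by omega) (by omega) (by omega) he.symm
    refine mem_blockSet_of_eq hg ?_ rfl
    unfold block; split_ifs <;> omega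
  · rintro ⟨p, q, r, s, hg, hb, rfl⟩
    have hg1 := hg
    unfold IsGenerator at hg
    obtain ⟨rfl, hq, hs⟩ : p = 0 ∧ 2 ≤ q ∧ s ≤ n + 1 := by
      unfold block at hb; split_ifs at hb <;> omega
    constructor
    · rw [J, K, edgeIdeal_mul,
        monomial_mem_monomialIdeal_of_degree hdeg (degree_expVec hg1)]
      -- The vertex `x` is paired with `r`, which leaves `{q, s}` as the edge of `H`.
      refine ⟨⟨q, by omega⟩, ⟨s, by omega⟩, ⟨0, by omega⟩, ⟨r, by omega⟩, ?_, ?_, ?_⟩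
      · rw [H_adj_iff]; simp only; omega
      · rw [K_adj_iff]; simp only [true_and]; omega
      · rw [exps_eq_expVec]
        exact expVec_congr fun u => by unfold count; ring
    · obtain ⟨q, rfl⟩ : ∃ q', q = q' + 2 := Nat.exists_eq_add_of_le' hq
      obtain ⟨r, rfl⟩ : ∃ r', r = r' + 2 := Nat.exists_eq_add_of_le' (by omega)
      obtain ⟨s, rfl⟩ : ∃ s', s = s' + 2 := Nat.exists_eq_add_of_le' (by omega)
      refine ⟨⟨q, by omega⟩, ⟨r, by omega⟩, ⟨s, by omega⟩, ?_, ?_,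
        (exps_x_y_y_y ⟨q, by omega⟩ ⟨r, by omega⟩ ⟨s, by omega⟩).symm⟩
      · rw [Fin.le_def]; simp only; omega
      · rw [Fin.le_def]; simp only; omega

theorem block3a_eq {n : ℕ} : block3a n = blockSet n 6 := by
  ext m
  constructor
  · rintro ⟨i, j, hij, hne, rfl⟩
    rw [Fin.le_def] at hij
    refine mem_blockSet_of_eq ?_ ?_ (exps_x_x_y_y i j)
    · unfold IsGenerator; omega
    · unfold block; split_ifs <;> omega
  · rintro ⟨p, q, r, s, hg, hb, rfl⟩
    unfold IsGenerator at hg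
    obtain ⟨rfl, rfl, hs⟩ : p = 0 ∧ q = 0 ∧ s ≠ 2 := by
      unfold block at hb; split_ifs at hb <;> omega
    obtain ⟨r, rfl⟩ : ∃ r', r = r' + 2 := Nat.exists_eq_add_of_le' (by omega)
    obtain ⟨s, rfl⟩ : ∃ s', s = s' + 2 := Nat.exists_eq_add_of_le' (by omega)
    refine ⟨⟨r, by omega⟩, ⟨s, by omega⟩, ?_, ?_,
      (exps_x_x_y_y ⟨r, by omega⟩ ⟨s, by omega⟩).symm⟩
    · rw [Fin.le_def]; simp only; omega
    · simp only; omega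

theorem block3b_eq {n : ℕ} (hn : 2 ≤ n) : block3b n = blockSet n 7 := by
  ext m
  constructor
  · rintro ⟨i, hi, rfl⟩
    refine mem_blockSet_of_eq ?_ ?_ (exps_x_x_y_y i i)
    · unfold IsGenerator; omega
    · unfold block; split_ifs <;> omega
  · rintro ⟨p, q, r, s, hg, hb, rfl⟩
    unfold IsGenerator at hg
    obtain ⟨rfl, rfl, rfl, rfl⟩ : p = 0 ∧ q = 0 ∧ r = 0 + 2 ∧ s = 0 + 2 := by
      unfold block at hb; split_ifs at hb <;> omega
    exact ⟨⟨0, by omega⟩, rfl, (exps_x_x_y_y ⟨0, by omega⟩ ⟨0, by omega⟩).symm⟩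

theorem isLexListing_map {n ρ i : ℕ} {above : Fin (n + 3) → Fin (n + 3) → Prop}
    {S : Set (Fin (n + 3) →₀ ℕ)} (hS : S = blockSet n i) {T : List (ℕ × ℕ × ℕ × ℕ)}
    (hT : ∀ t, t ∈ T ↔ t ∈ blockFinset n i) (hp : T.Pairwise (BeforeQ n ρ))
    (h : (i = ρ ∨ i = 4) ∧ above = (· > ·) ∨ ¬ (i = ρ ∨ i = 4) ∧ above = (· < ·)) :
    IsLexListing above S (T.map (expVec n)) := by
  subst hS
  constructor
  · intro m
    rw [List.mem_map]
    constructor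
    · rintro ⟨⟨p, q, r, s⟩, ht, rfl⟩
      obtain ⟨hg, hb⟩ := mem_blockFinset.1 ((hT _).1 ht)
      exact ⟨p, q, r, s, hg, hb, rfl⟩
    · rintro ⟨p, q, r, s, hg, hb, rfl⟩
      exact ⟨(p, q, r, s), (hT _).2 (mem_blockFinset.2 ⟨hg, hb⟩), rfl⟩
  · rw [List.pairwise_map]
    refine hp.imp_of_mem ?_
    rintro ⟨p', q', r', s'⟩ ⟨p, q, r, s⟩ ht' ht hlt
    obtain ⟨hg', hb'⟩ := mem_blockFinset.1 ((hT _).1 ht')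
    obtain ⟨hg, hb⟩ := mem_blockFinset.1 ((hT _).1 ht)
    simp only [BeforeQ, Before] at hg hg' hb hb' hlt
    rw [hb, hb'] at hlt
    unfold IsGenerator at hg hg'
    rcases h with ⟨h, rfl⟩ | ⟨h, rfl⟩
    · refine lex_gt_expVec (by omega) (by omega) (by omega) (by omega) (by omega) (by omega)
        (by omega) (by omega) ?_
      rcases hlt with hlt | ⟨-, hlt | hlt⟩
      · exact absurd hlt (lt_irrefl _)
      · exact hlt.2
      · exact absurd h hlt.1
    · refine lex_lt_expVec (by omega) (by omega) (by omega) (by omega) (by omega) (by omega)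
        (by omega) (by omega) ?_
      rcases hlt with hlt | ⟨-, hlt | hlt⟩
      · exact absurd hlt (lt_irrefl _)
      · exact absurd hlt.1 h
      · exact hlt.2

theorem isLinearQuotientsOrdering_map (k : Type*) [Field k] {n ρ : ℕ} (hn : 2 ≤ n) (hρ : ρ ≤ 1)
    {T : List (ℕ × ℕ × ℕ × ℕ)}
    (hT : ∀ t, t ∈ T ↔ IsGenerator n t.1 t.2.1 t.2.2.1 t.2.2.2)
    (hp : T.Pairwise (BeforeQ n ρ)) :
    IsLinearQuotientsOrdering (edgeIdeal k (anticycle (n + 3)) ^ 2) (T.map (expVec n)) := by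
  have hset : {m | m ∈ T.map (expVec n)} =
      {m | ∃ p q r s, IsGenerator n p q r s ∧ m = expVec n (p, q, r, s)} := by
    ext m
    change m ∈ T.map (expVec n) ↔ _
    rw [List.mem_map]
    constructor
    · rintro ⟨⟨p, q, r, s⟩, ht, rfl⟩
      exact ⟨p, q, r, s, (hT _).1 ht, rfl⟩
    · rintro ⟨p, q, r, s, hg, rfl⟩
      exact ⟨(p, q, r, s), (hT _).2 hg, rfl⟩
  have hdeg : ∀ m ∈ T.map (expVec n), m.degree = 4 := by
    intro m hm
    obtain ⟨⟨p, q, r, s⟩, ht, rfl⟩ := List.mem_map.1 hm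
    exact degree_expVec ((hT _).1 ht)
  refine ⟨?_, ?_, ?_, ?_⟩
  · refine List.Nodup.map_on ?_ (hp.imp fun {a b} h hab => ?_)
    · rintro ⟨p', q', r', s'⟩ ht' ⟨p, q, r, s⟩ ht h
      have hg' := (hT _).1 ht'
      have hg := (hT _).1 ht
      unfold IsGenerator at hg hg'
      simp only at hg hg'
      obtain ⟨rfl, rfl, rfl, rfl⟩ := expVec_injective (by omega) (by omega) (by omega) (by omega)
        (by omega) (by omega) (by omega) h
      rfl
    · subst hab
      exact irrefl_of (BeforeQ n ρ) a h
  · rw [hset, edgeIdeal_sq]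
  · intro m hm
    rw [monomial_mem_monomialIdeal_of_degree (fun s hs => hdeg s hs.1) (hdeg m hm)]
    exact fun h => h.2 rfl
  · intro i hi _
    refine ⟨_, colon_monomialIdeal ?_⟩
    rw [List.length_map] at hi
    -- As the list is sorted, its prefix of length `i` consists of all generators before the `i`-th,
    -- so witnesses of `Reach` lie in the prefix.
    have htake : ∀ t, t ∈ T.take i ↔
        IsGenerator n t.1 t.2.1 t.2.2.1 t.2.2.2 ∧ BeforeQ n ρ t T[i] := by
      intro t
      rw [hp.mem_take_iff (fun a b h h' => irrefl_of (BeforeQ n ρ) a (trans_of _ h h')) hi, hT]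
    have hgi := (hT _).1 (List.getElem_mem hi)
    simp only [List.getElem_map, ← List.map_take]
    revert htake hgi
    generalize T[i] = t
    obtain ⟨p, q, r, s⟩ := t
    intro htake hg m' hm'
    obtain ⟨⟨p', q', r', s'⟩, ht', rfl⟩ := List.mem_map.1 hm'
    obtain ⟨hg', hb'⟩ := (htake _).1 ht'
    obtain ⟨v, ⟨p₁, q₁, r₁, s₁, w, hg₁, hb₁, hc⟩, hlt⟩ := exists_reach hn hρ hg hg' hb'
    have hv : v < n + 3 := by
      unfold IsGenerator at hg'
      by_contra hv
      have : count p' q' r' s' v = 0 := by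
        simp only at hg'
        unfold count; split_ifs <;> omega
      simp only at hlt
      omega
    refine ⟨⟨v, hv⟩, ⟨expVec n (p₁, q₁, r₁, s₁),
      List.mem_map.2 ⟨_, (htake (p₁, q₁, r₁, s₁)).2 ⟨hg₁, hb₁⟩, rfl⟩, fun u => ?_⟩, hlt⟩
    have := hc u
    rw [Finsupp.add_apply, expVec_apply, expVec_apply, Finsupp.single_apply]
    simp only [Fin.ext_iff]
    simp only at this
    omega

/-- Each block is sorted separately; block numbers dominate `Before`, so the concatenation is sorted
too. Blocks are numbered from 1, so `ρ = 0` reverses only block (2c), while `ρ = 1` also reverses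
the block of `J²`. -/
theorem exists_anticycleOrdering (k : Type*) [Field k] {n ρ : ℕ} (hn : 2 ≤ n) (hρ : ρ ≤ 1)
    {above : Fin (n + 3) → Fin (n + 3) → Prop}
    (h : ρ = 1 ∧ above = (· > ·) ∨ ρ = 0 ∧ above = (· < ·)) :
    ∃ L, IsAnticycleOrdering k n above L ∧
      IsLinearQuotientsOrdering (edgeIdeal k (anticycle (n + 3)) ^ 2) L ∧
      ∀ m ∈ L, m.degree = 4 := by
  choose T hT hp using fun i => (blockFinset n i).exists_list_pairwise (BeforeQ n ρ)
  have hlt : ∀ i j, i < j → ∀ a ∈ T i, ∀ b ∈ T j, BeforeQ n ρ a b := by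
    intro i j hij a ha b hb
    have h1 := (mem_blockFinset.1 ((hT i a).1 ha)).2
    have h2 := (mem_blockFinset.1 ((hT j b).1 hb)).2
    exact Or.inl (by omega)
  have hpw : (T 1 ++ T 2 ++ T 3 ++ T 4 ++ T 5 ++ T 6 ++ T 7).Pairwise (BeforeQ n ρ) := by
    simp only [List.pairwise_append, List.mem_append, hp, true_and]
    refine ⟨⟨⟨⟨⟨?_, ?_⟩, ?_⟩, ?_⟩, ?_⟩, ?_⟩ <;> rintro a ha b hb
    · exact hlt _ _ (by norm_num) a ha b hb
    · rcases ha with ha | ha <;> exact hlt _ _ (by norm_num) a ha b hb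
    · rcases ha with (ha | ha) | ha <;> exact hlt _ _ (by norm_num) a ha b hb
    · rcases ha with ((ha | ha) | ha) | ha <;> exact hlt _ _ (by norm_num) a ha b hb
    · rcases ha with (((ha | ha) | ha) | ha) | ha <;> exact hlt _ _ (by norm_num) a ha b hb
    · rcases ha with ((((ha | ha) | ha) | ha) | ha) | ha <;>
        exact hlt _ _ (by norm_num) a ha b hb
  have hmem : ∀ t, t ∈ T 1 ++ T 2 ++ T 3 ++ T 4 ++ T 5 ++ T 6 ++ T 7 ↔
      IsGenerator n t.1 t.2.1 t.2.2.1 t.2.2.2 := by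
    intro t
    simp only [List.mem_append, hT, mem_blockFinset]
    constructor
    · rintro ((((((h | h) | h) | h) | h) | h) | h) <;> exact h.1
    · intro hg
      have : block n t.1 t.2.1 t.2.2.1 t.2.2.2 = 1 ∨ block n t.1 t.2.1 t.2.2.1 t.2.2.2 = 2 ∨
          block n t.1 t.2.1 t.2.2.1 t.2.2.2 = 3 ∨ block n t.1 t.2.1 t.2.2.1 t.2.2.2 = 4 ∨
          block n t.1 t.2.1 t.2.2.1 t.2.2.2 = 5 ∨ block n t.1 t.2.1 t.2.2.1 t.2.2.2 = 6 ∨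
          block n t.1 t.2.1 t.2.2.1 t.2.2.2 = 7 := by
        unfold block; split_ifs <;> simp
      tauto
  have hlq := isLinearQuotientsOrdering_map k hn hρ hmem hpw
  refine ⟨_, ⟨_, _, _, _, _, _, _,
    isLexListing_map (block1_eq k n) (hT 1) (hp 1) ?_,
    isLexListing_map (block2a_eq hn) (hT 2) (hp 2) (Or.inr ⟨by omega, rfl⟩),
    isLexListing_map block2b_eq (hT 3) (hp 3) (Or.inr ⟨by omega, rfl⟩),
    isLexListing_map block2c_eq (hT 4) (hp 4) (Or.inl ⟨by omega, rfl⟩),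
    isLexListing_map (block2d_eq k) (hT 5) (hp 5) (Or.inr ⟨by omega, rfl⟩),
    isLexListing_map block3a_eq (hT 6) (hp 6) (Or.inr ⟨by omega, rfl⟩),
    isLexListing_map (block3b_eq hn) (hT 7) (hp 7) (Or.inr ⟨by omega, rfl⟩), ?_⟩, hlq, ?_⟩
  · rcases h with ⟨rfl, rfl⟩ | ⟨rfl, rfl⟩
    · exact Or.inl ⟨Or.inl rfl, rfl⟩
    · exact Or.inr ⟨by omega, rfl⟩
  · simp only [List.map_append]
  · intro m hm
    obtain ⟨⟨p, q, r, s⟩, ht, rfl⟩ := List.mem_map.1 hm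
    exact degree_expVec ((hmem _).1 ht)

end Anticycle

end

theorem mainTheorem2 (k : Type*) [Field k] (n : ℕ) (hn : 2 ≤ n) :
    -- `K = (x yᵢ : i = 1, …, n)`
    Anticycle.K k n =
      Ideal.span (Set.range fun i : Fin n =>
        (MvPolynomial.X (Anticycle.x n) * MvPolynomial.X (Anticycle.y i) :
          MvPolynomial (Fin (n + 3)) k)) ∧
    -- linear quotients, with `J²` in lex order for `z₁ > y₁ > ⋯ > yₙ > z₂`
    (∃ L, Anticycle.IsAnticycleOrdering k n (· < ·) L ∧
      IsLinearQuotientsOrdering (edgeIdeal k (anticycle (n + 3)) ^ 2) L) ∧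
    -- linear quotients, with `J²` in lex order for `z₁ < y₁ < ⋯ < yₙ < z₂`
    (∃ L, Anticycle.IsAnticycleOrdering k n (· > ·) L ∧
      IsLinearQuotientsOrdering (edgeIdeal k (anticycle (n + 3)) ^ 2) L) ∧
    -- linear resolution
    HasLinearResolution (edgeIdeal k (anticycle (n + 3)) ^ 2) 4 := by
  obtain ⟨L, hL, hq, hdeg⟩ :=
    Anticycle.exists_anticycleOrdering k hn (Nat.zero_le 1) (Or.inr ⟨rfl, rfl⟩)
  obtain ⟨L', hL', hq', -⟩ :=
    Anticycle.exists_anticycleOrdering k hn le_rfl (Or.inl ⟨rfl, rfl⟩)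
  exact ⟨Anticycle.K_eq k n, ⟨L, hL, hq⟩, ⟨L', hL', hq'⟩, hq.hasLinearResolution hdeg⟩
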